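/- Let $\mathcal U=\langle S;P_1,\dots,P_r;L_1,\dots,L_r\rangle$, where $S\subseteq(0,\infty)$ is countable (possibly finite or empty), $P_1,\dots,P_r$ ($r\ge 0$) are relation symbols of arities $k_1,\dots,k_r\ge 1$, and $L_i$ is a subgroup of $\mathrm{Sym}(\{1,\dots,k_i\})$. Consider the relational language consisting of a binary symbol $E_s$ for each $s\in S$ together with $P_1,\dots,P_r$. A structure $X$ in this language is a *$\mathcal U$-structure* if 1. each $P_i^X$ is $L_i$-symmetric: for $\vartheta\in L_i$, $P_i^X(x_{\vartheta(1)},\dots,x_{\vartheta(k_i)})$ holds if and only if $P_i^X(x_1,\dots,x_{k_i})$ holds; 2. if $P_i^X(x_1,\dots,x_{k_i})$, then $x_1,\dots,x_{k_i}$ are distinct; 3. each $E_s^X$ is an equivalence relation, and $E_s^X\subseteq E_t^X$ for $s<t$ in $S$; 4. if $S\neq\emptyset$, then for all $x\ne y$ in $X$ there is a maximal $s\in S$ such that $(x,y)\notin E_s^X$. Let $\mathbf U$ be the randomised ultrametric space corresponding to $\mathcal U$, i.e. the Fraïssé limit of the class of finite $\mathcal U$-structures: the countable ultrahomogeneous structure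 (unique up to isomorphism) whose finite substructures are, up to isomorphism, exactly the finite $\mathcal U$-structures. Give $\mathrm{Aut}(\mathbf U)$ the topology of pointwise convergence, with $\mathbf U$ discrete. For a countable discrete group $\Delta$ let $\mathsf{Rep}(\Delta,\mathbf U)$ be the space of homomorphisms $\Delta\to\mathrm{Aut}(\mathbf U)$ (representations of $\Delta$ on $\mathbf U$), with the topology inherited from the product $\mathrm{Aut}(\mathbf U)^\Delta$. The group $\mathrm{Aut}(\mathbf U)$ acts on it by $(g\cdot\pi)(\delta)=g\,\pi(\delta)\,g^{-1}$, and $\pi$ is called *generic* if its orbit under this action is comeagre in $\mathsf{Rep}(\Delta,\mathbf U)$. **Theorem.** Let $\Gamma$ be a countable abelian group. Then there is a representation $\pi$ of $\Gamma$ on $\mathbf U$ such that for every finitely generated subgroup $\Delta\le\Gamma$ the restriction $\pi|_\Delta$ is generic in $\mathsf{Rep}(\Delta,\mathbf U)$. -/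

import Mathlib

open scoped FirstOrder

/-! ### Automorphism groups of first-order structures and spaces of representations -/

section Representations

variable {L : FirstOrder.Language} {U : Type*} [L.Structure U]

/-- The automorphism group `Aut(U)` of a first-order structure, under composition. -/
instance autGroup : Group (U ≃[L] U) where
  mul g h := g.comp h
  one := FirstOrder.Language.Equiv.refl L U
  inv g := g.symm
  mul_assoc _ _ _ := rfl
  one_mul _ := FirstOrder.Language.Equiv.ext fun _ => rfl
  mul_one _ := FirstOrder.Language.Equiv.ext fun _ => rfl
  inv_mul_cancel g := FirstOrder.Language.Equiv.ext fun x => g.symm_apply_apply x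

/-- The topology of pointwise convergence on `Aut(U)`, with `U` taken discrete. -/
instance autTopology : TopologicalSpace (U ≃[L] U) :=
  TopologicalSpace.induced (fun g x => g x)
    (@Pi.topologicalSpace U (fun _ => U) (fun _ => ⊥))

variable (L U) in
/-- `Rep(Γ, U)`: the representations of `Γ` on `U`, i.e. homomorphisms `Γ → Aut(U)`. -/
abbrev RepSpace (Γ : Type*) [Group Γ] := Γ →* (U ≃[L] U)

/-- `Rep(Γ, U)` is topologised as a subset of `Aut(U)^Γ` with the product topology. -/
instance repTopology (Γ : Type*) [Group Γ] : TopologicalSpace (Γ →* (U ≃[L] U)) :=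
  TopologicalSpace.induced (fun π γ => π γ) inferInstance

/-- The orbit of `π` under the action of `Aut(U)` on `Rep(Γ, U)` by conjugation. -/
def conjOrbit {Γ : Type*} [Group Γ] (π : RepSpace L U Γ) : Set (RepSpace L U Γ) :=
  {θ | ∃ g : U ≃[L] U, ∀ γ, θ γ = g * π γ * g⁻¹}

/-- A representation is generic if its orbit is comeagre in `Rep(Γ, U)`. -/
def IsGenericRep {Γ : Type*} [Group Γ] (π : RepSpace L U Γ) : Prop :=
  conjOrbit π ∈ residual (RepSpace L U Γ)

/-- The restriction `π|Δ` of a representation to a subgroup. -/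
def RepSpace.restrict {Γ : Type*} [Group Γ] (π : RepSpace L U Γ) (Δ : Subgroup Γ) :
    RepSpace L U Δ :=
  MonoidHom.comp π Δ.subtype

end Representations

/-! ### Randomised ultrametric spaces -/

/-- A tuple `⟨S; P₁, …, P_r; L₁, …, L_r⟩`: a countable set `S` of positive reals, finitely many
relation symbols of positive arity, and for each one a group of permutations of its places. -/
structure UTuple where
  S : Set ℝ
  S_countable : S.Countable
  S_pos : ∀ s ∈ S, 0 < s
  r : ℕ
  arity : Fin r → ℕ
  arity_pos : ∀ i, 0 < arity i
  symm : ∀ i, Subgroup (Equiv.Perm (Fin (arity i)))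

namespace UTuple

variable (𝒰 : UTuple)

/-- The relation symbols: a binary `E_s` for each `s ∈ S`, and `P₁, …, P_r`. -/
inductive RelSymbol : ℕ → Type
  | E (s : 𝒰.S) : RelSymbol 2
  | P (i : Fin 𝒰.r) : RelSymbol (𝒰.arity i)

/-- The relational language `{E_s : s ∈ S} ∪ {P₁, …, P_r}`. -/
def lang : FirstOrder.Language.{0, 0} where
  Functions _ := Empty
  Relations := 𝒰.RelSymbol

instance (n : ℕ) : IsEmpty (𝒰.lang.Functions n) := inferInstanceAs (IsEmpty Empty)

variable {𝒰} {X : Type*} [𝒰.lang.Structure X]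

/-- The interpretation of `E_s` in `X`. -/
def relE (s : 𝒰.S) (x y : X) : Prop :=
  FirstOrder.Language.Structure.RelMap (L := 𝒰.lang) (RelSymbol.E s : 𝒰.lang.Relations 2) ![x, y]

/-- The interpretation of `P_i` in `X`. -/
def relP (i : Fin 𝒰.r) (x : Fin (𝒰.arity i) → X) : Prop :=
  FirstOrder.Language.Structure.RelMap (L := 𝒰.lang) (RelSymbol.P i : 𝒰.lang.Relations (𝒰.arity i)) x

variable (𝒰 X) in
/-- The `𝒰`-structures. For `S = ∅` there are no relations `E_s`, and the last condition
is not imposed: a `𝒰`-structure is then a purely relational structure. -/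
structure IsUStructure : Prop where
  symmetric : ∀ i, ∀ ϑ ∈ 𝒰.symm i, ∀ x : Fin (𝒰.arity i) → X, relP i (x ∘ ϑ) ↔ relP i x
  distinct : ∀ i, ∀ x : Fin (𝒰.arity i) → X, relP i x → Function.Injective x
  equivalence : ∀ s : 𝒰.S, Equivalence (relE s : X → X → Prop)
  nested : ∀ s t : 𝒰.S, s < t → ∀ x y : X, relE s x y → relE t x y
  exists_max : 𝒰.S.Nonempty → ∀ x y : X, x ≠ y → ∃ s : 𝒰.S, IsGreatest {s : 𝒰.S | ¬ relE s x y} s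

variable (𝒰) in
/-- The class of all finite `𝒰`-structures. -/
def finiteUStructures.{w} : Set (CategoryTheory.Bundled.{w} 𝒰.lang.Structure) :=
  {M | Finite M ∧ 𝒰.IsUStructure M}

variable (𝒰 X) in
/-- `X` is the randomised ultrametric space corresponding to `𝒰`: the Fraïssé limit of the class
of finite `𝒰`-structures, i.e. the countable ultrahomogeneous structure with this class as age. -/
def IsRandomisedUltrametricSpace [Countable X] : Prop :=
  FirstOrder.Language.IsFraisseLimit 𝒰.finiteUStructures X

end UTuple

/-! Call a representation saturated if its orbits are finite and it realises, over each of its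
finite invariant parts, every extension to a finite invariant part of another representation
(`IsSaturated`). Back-and-forth makes any two saturated representations conjugate. For a finitely
generated abelian group they form a comeagre set, so saturated implies generic. Saturation passes to
subgroups (`IsSaturated.comp`). Hence a saturated representation of a smaller group is conjugate to
the restriction of one of a larger group, and conjugating the latter extends the former. Exhausting
`Γ` by a chain of finitely generated subgroups gives a representation whose restriction to every
finitely generated subgroup is saturated.

Everything rests on amalgamation (`exists_finRep_amalgam`): a finite `Λ`-invariant `B` and a finite
`Δ`-invariant `C`, with `Δ` embedded in `Λ`, must be amalgamated over a common `Δ`-invariant part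
`A` into a finite structure on which `Λ` acts. The natural amalgam consists of `B` and the copies of
`C` indexed by the cosets of `Δ`, which may be infinitely many. It is described by relations on `Λ ×
W` with `W` finite (`IsGluing`), then made finite by identifying translates that differ by `n!`-th
powers (`IsGluing.exists_finite_realization`).

For large `n` nothing new happens inside the charts `B` and `C`. The elements moving one class of a
level to another form a coset of a stabiliser, and in a finitely generated abelian group such a
coset, if it misses the identity, misses all `n!`-th powers for large `n`. For the relations `P_i`
the same argument runs in a power of `Λ`, with the product of the diagonal and the stabilisers, a
subgroup because `Λ` is abelian. Only finitely many distances occur in the charts, and the quotient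
is metrised by these alone. -/

open FirstOrder Set

namespace UTuple

variable {𝒰 : UTuple}

/-! ### Partial embeddings of structures -/

section Basic

variable {X Y Z : Type*} [𝒰.lang.Structure X] [𝒰.lang.Structure Y] [𝒰.lang.Structure Z]

/-- `h` restricts to an embedding of structures on the set `V`. -/
structure IsEmbOn (𝒰 : UTuple) {X Y : Type*} [𝒰.lang.Structure X] [𝒰.lang.Structure Y]
    (V : Set X) (h : X → Y) : Prop where
  injOn : InjOn h V
  relE_iff : ∀ s : 𝒰.S, ∀ x ∈ V, ∀ y ∈ V, relE s (h x) (h y) ↔ relE s x y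
  relP_iff : ∀ i, ∀ x : Fin (𝒰.arity i) → X, (∀ k, x k ∈ V) → (relP i (h ∘ x) ↔ relP i x)

theorem IsEmbOn.comp {V : Set X} {W : Set Y} {f : X → Y} {g : Y → Z} (hg : 𝒰.IsEmbOn W g)
    (hf : 𝒰.IsEmbOn V f) (hVW : MapsTo f V W) : 𝒰.IsEmbOn V (g ∘ f) where
  injOn := hg.injOn.comp hf.injOn hVW
  relE_iff s x hx y hy :=
    (hg.relE_iff s _ (hVW hx) _ (hVW hy)).trans (hf.relE_iff s x hx y hy)
  relP_iff i x hx :=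
    (hg.relP_iff i (f ∘ x) fun k => hVW (hx k)).trans (hf.relP_iff i x hx)

theorem IsEmbOn.congr {V : Set X} {f g : X → Y} (hf : 𝒰.IsEmbOn V f) (h : EqOn f g V) :
    𝒰.IsEmbOn V g where
  injOn := hf.injOn.congr h
  relE_iff s x hx y hy := by rw [← h hx, ← h hy]; exact hf.relE_iff s x hx y hy
  relP_iff i x hx := by
    rw [← hf.relP_iff i x hx, show g ∘ x = f ∘ x from funext fun k => (h (hx k)).symm]

theorem isEmbOn_id (V : Set X) : 𝒰.IsEmbOn V (id : X → X) :=
  ⟨injOn_id V, fun _ _ _ _ _ => Iff.rfl, fun _ _ _ => Iff.rfl⟩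

theorem relE_map_iff {F : Type*} [FunLike F X Y] [Language.StrongHomClass 𝒰.lang F X Y]
    (f : F) (s : 𝒰.S) (x y : X) : relE s (f x) (f y) ↔ relE s x y := by
  have h := Language.StrongHomClass.map_rel f (RelSymbol.E s : 𝒰.lang.Relations 2) ![x, y]
  rw [show f ∘ ![x, y] = ![f x, f y] from funext fun k => by fin_cases k <;> rfl] at h
  exact h

theorem relP_map_iff {F : Type*} [FunLike F X Y] [Language.StrongHomClass 𝒰.lang F X Y]
    (f : F) (i : Fin 𝒰.r) (x : Fin (𝒰.arity i) → X) : relP i (f ∘ x) ↔ relP i x :=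
  Language.StrongHomClass.map_rel f _ x

theorem _root_.FirstOrder.Language.Embedding.isEmbOn (f : X ↪[𝒰.lang] Y) (V : Set X) :
    𝒰.IsEmbOn V f :=
  ⟨f.injective.injOn, fun s x _ y _ => relE_map_iff f s x y, fun i x _ => relP_map_iff f i x⟩

theorem _root_.FirstOrder.Language.Equiv.isEmbOn (f : X ≃[𝒰.lang] Y) (V : Set X) :
    𝒰.IsEmbOn V f :=
  ⟨f.injective.injOn, fun s x _ y _ => relE_map_iff f s x y, fun i x _ => relP_map_iff f i x⟩

theorem relMap_iff {f : X → Y} (hE : ∀ s x y, relE (𝒰 := 𝒰) s (f x) (f y) ↔ relE s x y)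
    (hP : ∀ i x, relP (𝒰 := 𝒰) i (f ∘ x) ↔ relP i x) {n : ℕ} (R : 𝒰.lang.Relations n)
    (x : Fin n → X) :
    Language.Structure.RelMap R (f ∘ x) ↔ Language.Structure.RelMap R x := by
  cases R with
  | E s =>
    have := hE s (x 0) (x 1)
    unfold relE at this
    convert this using 2 <;> ext k <;> fin_cases k <;> rfl
  | P i => exact hP i x

/-- A bijection preserving the relations, as an isomorphism of structures. -/
def equivOfIff (f : X ≃ Y) (hE : ∀ s x y, relE (𝒰 := 𝒰) s (f x) (f y) ↔ relE s x y)
    (hP : ∀ i x, relP (𝒰 := 𝒰) i (f ∘ x) ↔ relP i x) : X ≃[𝒰.lang] Y where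
  toEquiv := f
  map_fun' F := isEmptyElim F
  map_rel' R x := relMap_iff hE hP R x

/-- An injection preserving the relations, as an embedding of structures. -/
def embeddingOfIff (f : X ↪ Y) (hE : ∀ s x y, relE (𝒰 := 𝒰) s (f x) (f y) ↔ relE s x y)
    (hP : ∀ i x, relP (𝒰 := 𝒰) i (f ∘ x) ↔ relP i x) : X ↪[𝒰.lang] Y where
  toEmbedding := f
  map_fun' F := isEmptyElim F
  map_rel' R x := relMap_iff hE hP R x

theorem IsUStructure.of_embedding (f : X ↪[𝒰.lang] Y) (hY : 𝒰.IsUStructure Y) :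
    𝒰.IsUStructure X where
  symmetric i ϑ hϑ x := by
    rw [← relP_map_iff f, ← relP_map_iff f]
    exact hY.symmetric i ϑ hϑ (f ∘ x)
  distinct i x hx :=
    (hY.distinct i (f ∘ x) ((relP_map_iff f i x).2 hx)).of_comp
  equivalence s := by
    have := hY.equivalence s
    refine ⟨fun x => ?_, fun {x y} h => ?_, fun {x y z} h h' => ?_⟩
    · rw [← relE_map_iff f]; exact this.refl _
    · rw [← relE_map_iff f] at h ⊢; exact this.symm h
    · rw [← relE_map_iff f] at h h' ⊢; exact this.trans h h'
  nested s t hst x y h := by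
    rw [← relE_map_iff f] at h ⊢
    exact hY.nested s t hst _ _ h
  exists_max hS x y hxy := by
    simpa only [relE_map_iff f] using hY.exists_max hS (f x) (f y) (f.injective.ne hxy)

/-- The substructure on a subset of a structure in the relational language of `𝒰`. -/
def substructureOf (V : Set X) : 𝒰.lang.Substructure X where
  carrier := V
  fun_mem F := isEmptyElim F

end Basic

/-! ### Homogeneity and the extension property of the Fraïssé limit -/

section Limit

universe u

variable {U : Type u} [Countable U] [𝒰.lang.Structure U]

theorem IsRandomisedUltrametricSpace.exists_aut (hU : 𝒰.IsRandomisedUltrametricSpace U)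
    {V : Set U} (hV : V.Finite) {h : U → U} (hh : 𝒰.IsEmbOn V h) :
    ∃ g : U ≃[𝒰.lang] U, EqOn g h V := by
  let S : 𝒰.lang.Substructure U := substructureOf V
  have : Finite S := hV
  let f : S ↪[𝒰.lang] U := embeddingOfIff
    ⟨fun x => h x, fun x y hxy => Subtype.ext (hh.injOn x.2 y.2 hxy)⟩
    (fun s x y => (hh.relE_iff s x x.2 y y.2).trans (relE_map_iff S.subtype s x y))
    (fun i x => (hh.relP_iff i (fun k => x k) fun k => (x k).2).trans
      (relP_map_iff S.subtype i x))
  obtain ⟨g, hg⟩ := hU.ultrahomogeneous S (Language.Substructure.fg_iff_finite.2 this) f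
  exact ⟨g, fun x hx => (DFunLike.congr_fun hg (⟨x, hx⟩ : S)).symm⟩

theorem IsRandomisedUltrametricSpace.isUStructure_subset
    (hU : 𝒰.IsRandomisedUltrametricSpace U) (V : Set U) (hV : V.Finite) :
    𝒰.IsUStructure (substructureOf V : 𝒰.lang.Substructure U) := by
  have : Finite (substructureOf V : 𝒰.lang.Substructure U) := hV
  have h : (⟨(substructureOf V : 𝒰.lang.Substructure U), inferInstance⟩ :
      CategoryTheory.Bundled 𝒰.lang.Structure) ∈ 𝒰.lang.age U :=
    ⟨Language.Structure.FG.of_finite, ⟨(substructureOf V).subtype⟩⟩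
  rw [hU.age] at h
  exact h.2

/-- Each axiom concerns finitely many points at a time, so it can be checked in a finite
substructure, which belongs to the age. -/
theorem IsRandomisedUltrametricSpace.isUStructure
    (hU : 𝒰.IsRandomisedUltrametricSpace U) : 𝒰.IsUStructure U where
  symmetric i ϑ hϑ x := by
    have h := (hU.isUStructure_subset _ (finite_range x)).symmetric i ϑ hϑ
      fun k => ⟨x k, mem_range_self k⟩
    rwa [← relP_map_iff (Language.Substructure.subtype _),
      ← relP_map_iff (Language.Substructure.subtype _)] at h
  distinct i x hx := by
    have h := (hU.isUStructure_subset _ (finite_range x)).distinct i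
      fun k => ⟨x k, mem_range_self k⟩
    rw [← relP_map_iff (Language.Substructure.subtype _)] at h
    exact fun k l hkl => h hx (Subtype.ext hkl)
  equivalence s := by
    refine ⟨fun x => ?_, fun {x y} h => ?_, fun {x y z} h h' => ?_⟩
    · exact (relE_map_iff (Language.Substructure.subtype _) s _ _).2
        (((hU.isUStructure_subset {x} (toFinite _)).equivalence s).refl ⟨x, mem_singleton x⟩)
    · have := ((hU.isUStructure_subset {x, y} (toFinite _)).equivalence s).symm
        (x := ⟨x, Or.inl rfl⟩) (y := ⟨y, Or.inr rfl⟩)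
      rw [← relE_map_iff (Language.Substructure.subtype _),
        ← relE_map_iff (Language.Substructure.subtype _)] at this
      exact this h
    · have := ((hU.isUStructure_subset {x, y, z} (toFinite _)).equivalence s).trans
        (x := ⟨x, Or.inl rfl⟩) (y := ⟨y, Or.inr (Or.inl rfl)⟩) (z := ⟨z, Or.inr (Or.inr rfl)⟩)
      rw [← relE_map_iff (Language.Substructure.subtype _),
        ← relE_map_iff (Language.Substructure.subtype _),
        ← relE_map_iff (Language.Substructure.subtype _)] at this
      exact this h h'
  nested s t hst x y h := by
    have := (hU.isUStructure_subset {x, y} (toFinite _)).nested s t hst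
        ⟨x, Or.inl rfl⟩ ⟨y, Or.inr rfl⟩
    rw [← relE_map_iff (Language.Substructure.subtype _),
      ← relE_map_iff (Language.Substructure.subtype _)] at this
    exact this h
  exists_max hS x y hxy := by
    have := (hU.isUStructure_subset {x, y} (toFinite _)).exists_max hS
        ⟨x, Or.inl rfl⟩ ⟨y, Or.inr rfl⟩ fun h => hxy (congrArg Subtype.val h)
    obtain ⟨s, hs⟩ := this
    have hE : ∀ t : 𝒰.S, relE t (⟨x, Or.inl rfl⟩ : substructureOf (𝒰 := 𝒰) {x, y})
        ⟨y, Or.inr rfl⟩ ↔ relE t x y :=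
      fun t => (relE_map_iff (Language.Substructure.subtype _) t _ _).symm
    simp only [hE] at hs
    exact ⟨s, hs⟩

theorem IsRandomisedUltrametricSpace.exists_embedding
    (hU : 𝒰.IsRandomisedUltrametricSpace U) {D : Type*} [Finite D] [𝒰.lang.Structure D]
    (hD : 𝒰.IsUStructure D) : Nonempty (D ↪[𝒰.lang] U) := by
  obtain ⟨n, ⟨e⟩⟩ := Finite.exists_equiv_fin D
  let e' : D ≃ ULift.{u} (Fin n) := e.trans Equiv.ulift.symm
  let _ : 𝒰.lang.Structure (ULift.{u} (Fin n)) := e'.inducedStructure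
  let f : D ≃[𝒰.lang] ULift.{u} (Fin n) := e'.inducedStructureEquiv
  have h : (⟨ULift.{u} (Fin n), inferInstance⟩ : CategoryTheory.Bundled 𝒰.lang.Structure) ∈
      𝒰.finiteUStructures :=
    ⟨inferInstanceAs (Finite (ULift.{u} (Fin n))), hD.of_embedding f.symm.toEmbedding⟩
  rw [← hU.age] at h
  exact ⟨h.2.some.comp f.toEmbedding⟩

/-- The extension property: a finite `𝒰`-structure over a finite part of `U` is realised in `U`. -/
theorem IsRandomisedUltrametricSpace.exists_embedding_over
    (hU : 𝒰.IsRandomisedUltrametricSpace U) {D : Type*} [Finite D] [𝒰.lang.Structure D]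
    (hD : 𝒰.IsUStructure D) {V : Set U} (hV : V.Finite) {q : U → D} (hq : 𝒰.IsEmbOn V q) :
    ∃ j : D ↪[𝒰.lang] U, ∀ v ∈ V, j (q v) = v := by
  obtain ⟨j⟩ := hU.exists_embedding hD
  obtain ⟨g, hg⟩ := hU.exists_aut hV ((j.isEmbOn univ).comp hq (mapsTo_univ _ _))
  refine ⟨g.symm.toEmbedding.comp j, fun v hv => ?_⟩
  change g.symm (j (q v)) = v
  rw [show j (q v) = g v from (hg hv).symm, Language.Equiv.symm_apply_apply]

end Limit

end UTuple

/-! ### Chains meeting cofinal sets, and separability in abelian groups -/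

theorem exists_chain_meeting {P ι : Type*} [Countable ι] {le : P → P → Prop}
    (hrefl : ∀ p, le p p) (htrans : ∀ p q r, le p q → le q r → le p r) (p : P)
    (D : ι → Set P) (hD : ∀ i q, ∃ r ∈ D i, le q r) :
    ∃ f : ℕ → P, (∀ n, le p (f n)) ∧ (∀ m n, m ≤ n → le (f m) (f n)) ∧ ∀ i, ∃ n, f n ∈ D i := by
  let _ : Preorder P := { le := le, le_refl := hrefl, le_trans := htrans }
  have := Encodable.ofCountable ι
  let 𝒟 : ι → Order.Cofinal P := fun i => ⟨D i, fun q => hD i q⟩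
  exact ⟨Order.sequenceOfCofinals p 𝒟,
    fun n => Order.sequenceOfCofinals.monotone p 𝒟 (Nat.zero_le n),
    fun m n h => Order.sequenceOfCofinals.monotone p 𝒟 h,
    fun i => ⟨_, Order.sequenceOfCofinals.encode_mem p 𝒟 i⟩⟩

/-- By the structure theorem `G` is a free abelian group times a finite product of cyclic groups. If
the free part of `g` vanishes, the product of the orders kills every torsion part, so no such power
is `g`. Otherwise some integer coordinate `z` of `g` is nonzero, and `|z| + 1` does not divide it.
-/
theorem CommGroup.exists_pow_ne {G : Type*} [CommGroup G] [Group.FG G] {g : G} (hg : g ≠ 1) :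
    ∃ m : ℕ, 0 < m ∧ ∀ a : G, a ^ m ≠ g := by
  obtain ⟨ι, j, _, _, p, hp, e, ⟨f⟩⟩ := CommGroup.equiv_free_prod_prod_multiplicative_zmod G
  by_cases hz : (f g).1 = 1
  · refine ⟨∏ i, p i ^ e i, Finset.prod_pos fun i _ => pow_pos (hp i).pos _, ?_⟩
    rintro a rfl
    refine hg (f.injective ?_)
    rw [map_one]
    refine Prod.ext hz (funext fun i => ?_)
    rw [map_pow, Prod.pow_snd, Pi.pow_apply]
    apply Multiplicative.toAdd.injective
    rw [toAdd_pow, Prod.snd_one, Pi.one_apply, toAdd_one, nsmul_eq_mul,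
      (ZMod.natCast_eq_zero_iff _ _).2 (Finset.dvd_prod_of_mem _ (Finset.mem_univ i)), zero_mul]
  · obtain ⟨i, hi⟩ := Function.ne_iff.1 hz
    have hi' : (Multiplicative.toAdd ((f g).1 i)) ≠ 0 := fun h =>
      hi (Multiplicative.toAdd.injective h)
    refine ⟨(Multiplicative.toAdd ((f g).1 i)).natAbs + 1, Nat.succ_pos _, ?_⟩
    rintro a ha
    have h1 : Multiplicative.toAdd ((f g).1 i) =
        ((Multiplicative.toAdd ((f g).1 i)).natAbs + 1 : ℕ) *
          Multiplicative.toAdd ((f a).1 i) := by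
      conv_lhs => rw [← ha, map_pow, Prod.pow_fst, Pi.pow_apply, toAdd_pow, nsmul_eq_mul]
    have h2 := Int.natAbs_dvd_natAbs.2 (Dvd.intro _ h1.symm)
    have h3 := Nat.le_of_dvd (Int.natAbs_pos.2 hi') h2
    rw [Int.natAbs_natCast] at h3
    omega

/-- Subgroups of finitely generated abelian groups are separable, by subgroups of powers. -/
theorem Subgroup.eventually_mul_pow_factorial_notMem {G : Type*} [CommGroup G] [Group.FG G]
    (M : Subgroup G) {g : G} (hg : g ∉ M) :
    ∀ᶠ n : ℕ in Filter.atTop, ∀ a : G, g * a ^ n.factorial ∉ M := by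
  have : (g : G ⧸ M) ≠ 1 := fun h => hg ((QuotientGroup.eq_one_iff g).1 h)
  obtain ⟨m, hm, h⟩ := CommGroup.exists_pow_ne this
  -- Once `n ≥ m`, the number `m` divides `n!`, so an `n!`-th power is an `m`-th power in the
  -- quotient by `M`.
  filter_upwards [Filter.eventually_ge_atTop m] with n hn a ha
  obtain ⟨d, hd⟩ := Nat.dvd_factorial hm hn
  refine h (((a⁻¹ : G) : G ⧸ M) ^ d) ?_
  have h1 : (g : G ⧸ M) * (a : G ⧸ M) ^ n.factorial = 1 := (QuotientGroup.eq_one_iff _).2 ha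
  rw [← pow_mul, mul_comm d, ← hd, QuotientGroup.mk_inv, inv_pow]
  exact (eq_inv_of_mul_eq_one_left h1).symm

namespace UTuple

variable {𝒰 : UTuple}

/-! ### Levels of the ultrametric and structures with finitely many distances -/

section Levels

variable {X Y : Type*} [𝒰.lang.Structure X] [𝒰.lang.Structure Y]

/-- The equivalence relations `E_s`, together with equality as a bottom level. -/
def relAt (t : WithBot 𝒰.S) (x y : X) : Prop :=
  WithBot.recBotCoe (C := fun _ => Prop) (x = y) (fun s => relE s x y) t

@[simp] theorem relAt_bot (x y : X) : relAt (⊥ : WithBot 𝒰.S) x y ↔ x = y := Iff.rfl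

theorem IsUStructure.relAt_equivalence (hX : 𝒰.IsUStructure X) (t : WithBot 𝒰.S) :
    Equivalence (relAt t : X → X → Prop) := by
  induction t with
  | bot => exact eq_equivalence
  | coe s => exact hX.equivalence s

theorem IsUStructure.relAt_of_eq (hX : 𝒰.IsUStructure X) (t : WithBot 𝒰.S) {x y : X}
    (h : x = y) : relAt t x y :=
  h ▸ (hX.relAt_equivalence t).refl x

theorem IsUStructure.relE_mono (hX : 𝒰.IsUStructure X) {s t : 𝒰.S} (hst : s ≤ t) {x y : X}
    (h : relE s x y) : relE t x y := by
  rcases hst.eq_or_lt with rfl | hlt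
  · exact h
  · exact hX.nested s t hlt x y h

theorem IsEmbOn.relAt_iff {V : Set X} {h : X → Y} (hh : 𝒰.IsEmbOn V h) (t : WithBot 𝒰.S)
    {x y : X} (hx : x ∈ V) (hy : y ∈ V) : relAt t (h x) (h y) ↔ relAt t x y := by
  induction t with
  | bot => exact hh.injOn.eq_iff hx hy
  | coe s => exact hh.relE_iff s x hx y hy

/-- The structure with prescribed interpretations of the relation symbols. -/
@[reducible] def mkStructure {X : Type*} (E : 𝒰.S → X → X → Prop)
    (P : ∀ i, (Fin (𝒰.arity i) → X) → Prop) : 𝒰.lang.Structure X where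
  funMap F := isEmptyElim F
  RelMap {n} R :=
    match n, R with
    | _, RelSymbol.E s => fun x => E s (x 0) (x 1)
    | _, RelSymbol.P i => P i

/-- Equivalence relations indexed by a finite set `T` of levels, spread out over all levels. -/
def coarsening {X : Type*} (T : Finset 𝒰.S) (D : 𝒰.S → X → X → Prop) (s : 𝒰.S) (x y : X) : Prop :=
  x = y ∨ (∃ t ∈ T, t < s) ∧ ∀ t ∈ T, s ≤ t → D t x y

section Coarsening

variable {X : Type*} {T : Finset 𝒰.S} {D : 𝒰.S → X → X → Prop}

theorem coarsening_equivalence (hD : ∀ t, Equivalence (D t)) (s : 𝒰.S) :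
    Equivalence (coarsening T D s) where
  refl x := Or.inl rfl
  symm := by
    rintro x y (rfl | ⟨ht, h⟩)
    · exact Or.inl rfl
    · exact Or.inr ⟨ht, fun t hT hst => (hD t).symm (h t hT hst)⟩
  trans := by
    rintro x y z (rfl | ⟨ht, h⟩) (rfl | ⟨ht', h'⟩)
    · exact Or.inl rfl
    · exact Or.inr ⟨ht', h'⟩
    · exact Or.inr ⟨ht, h⟩
    · exact Or.inr ⟨ht, fun t hT hst => (hD t).trans (h t hT hst) (h' t hT hst)⟩

/-- The relations `D` need not be nested: intersecting over all levels of `T` from `s` upwards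
forces monotonicity. -/
theorem coarsening_nested {s t : 𝒰.S} (hst : s < t) {x y : X} (h : coarsening T D s x y) :
    coarsening T D t x y := by
  rcases h with rfl | ⟨⟨u, hu, hus⟩, h⟩
  · exact Or.inl rfl
  · exact Or.inr ⟨⟨u, hu, hus.trans hst⟩, fun v hv htv => h v hv (hst.le.trans htv)⟩

/-- Distinct points are unrelated at the least element of `T`, since no member of `T` lies below it.
The greatest member of the finite set `T` at which they are unrelated is then greatest in all of
`S`, whatever the order type of `S`. -/
theorem coarsening_exists_max (hT : T.Nonempty) {x y : X} (hxy : x ≠ y) :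
    ∃ s : 𝒰.S, IsGreatest {s : 𝒰.S | ¬ coarsening T D s x y} s := by
  classical
  have hmin : T.min' hT ∈ T.filter fun t => ¬ coarsening T D t x y := by
    refine Finset.mem_filter.2 ⟨T.min'_mem hT, ?_⟩
    rintro (h | ⟨⟨t, ht, hlt⟩, -⟩)
    · exact hxy h
    · exact (T.min'_le t ht).not_gt hlt
  have hne : (T.filter fun t => ¬ coarsening T D t x y).Nonempty := ⟨_, hmin⟩
  have hmem := Finset.mem_filter.1 (Finset.max'_mem _ hne)
  refine ⟨_, hmem.2, fun s hs => ?_⟩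
  by_contra! hlt
  refine hs (Or.inr ⟨⟨_, hmem.1, hlt⟩, fun t ht hst => ?_⟩)
  by_contra hD
  have : t ∈ T.filter fun t => ¬ coarsening T D t x y := by
    refine Finset.mem_filter.2 ⟨ht, ?_⟩
    rintro (h | ⟨-, h⟩)
    · exact hxy h
    · exact hD (h t ht le_rfl)
  exact (hlt.trans_le hst).not_ge (Finset.le_max' _ _ this)

end Coarsening

end Levels

/-! ### Gluings of finitely many orbits and their finite quotients -/

section Gluing

/-- The structures pulled back along `q` and `e` agree on `C`. -/
structure SameOn (𝒰 : UTuple) {W X Y : Type*} [𝒰.lang.Structure X] [𝒰.lang.Structure Y]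
    (C : Set W) (q : W → Y) (e : W → X) : Prop where
  eq_iff : ∀ w ∈ C, ∀ w' ∈ C, q w = q w' ↔ e w = e w'
  relE_iff : ∀ s : 𝒰.S, ∀ w ∈ C, ∀ w' ∈ C, relE s (q w) (q w') ↔ relE s (e w) (e w')
  relP_iff : ∀ i, ∀ w : Fin (𝒰.arity i) → W, (∀ k, w k ∈ C) → (relP i (q ∘ w) ↔ relP i (e ∘ w))

/-- A description of an action of `Λ` on a `𝒰`-structure generated by points indexed by `W`:
`R t (a, w) (b, v)` says that the translates `a • w` and `b • v` are related at level `t`. On each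
member of `charts` the structure is the one pulled back along `e`, and the relations `P_i` hold
only for translates of tuples in a chart. -/
structure IsGluing {U Λ W : Type*} [𝒰.lang.Structure U] [CommGroup Λ] (e : W → U)
    (charts : Set (Set W)) (R : WithBot 𝒰.S → Λ × W → Λ × W → Prop) : Prop where
  equivalence : ∀ t, Equivalence (R t)
  of_bot : ∀ t z z', R ⊥ z z' → R t z z'
  smul : ∀ t (a : Λ) z z', R t z z' → R t (a * z.1, z.2) (a * z'.1, z'.2)
  chart : ∀ C ∈ charts, ∀ w ∈ C, ∀ w' ∈ C, ∀ t, R t (1, w) (1, w') ↔ relAt t (e w) (e w')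
  relP_of_rel : ∀ C ∈ charts, ∀ C' ∈ charts, ∀ i (a : Λ) (w w' : Fin (𝒰.arity i) → W),
    (∀ k, w k ∈ C) → (∀ k, w' k ∈ C') → (∀ k, R ⊥ (a, w k) (1, w' k)) →
      relP i (e ∘ w) → relP i (e ∘ w')

namespace IsGluing

variable {U Λ W : Type*} [𝒰.lang.Structure U] [CommGroup Λ] {e : W → U}
  {charts : Set (Set W)} {R : WithBot 𝒰.S → Λ × W → Λ × W → Prop}

/-- The stabiliser of the class of a point at level `t`. -/
def stab (h : IsGluing e charts R) (t : WithBot 𝒰.S) (w : W) : Subgroup Λ where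
  carrier := {a | R t (a, w) (1, w)}
  one_mem' := (h.equivalence t).refl _
  mul_mem' {a b} ha hb := by
    have := h.smul t a _ _ hb
    simp only [mul_one] at this
    exact (h.equivalence t).trans this ha
  inv_mem' {a} ha := by
    have := h.smul t a⁻¹ _ _ ha
    simp only [mul_one, inv_mul_cancel] at this
    exact (h.equivalence t).symm this

theorem mul_inv_mem_stab (h : IsGluing e charts R) {t : WithBot 𝒰.S} {w w' : W} {a b : Λ}
    (ha : R t (a, w) (1, w')) (hb : R t (b, w) (1, w')) : b⁻¹ * a ∈ h.stab t w := by
  have := h.smul t b⁻¹ _ _ ((h.equivalence t).trans ha ((h.equivalence t).symm hb))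
  rwa [inv_mul_cancel] at this

theorem of_mul_inv_mem_stab (h : IsGluing e charts R) {t : WithBot 𝒰.S} {w w' : W} {a b : Λ}
    (hab : b⁻¹ * a ∈ h.stab t w) (hb : R t (b, w) (1, w')) : R t (a, w) (1, w') := by
  have := h.smul t b _ _ hab
  simp only [mul_inv_cancel_left, mul_one] at this
  exact (h.equivalence t).trans this hb

/-- The elements carrying `w` to `w'` at level `t` are either none or a coset of the stabiliser. If
the identity is not in that coset, separability keeps it away from all `n!`-th powers for large `n`.
-/
theorem eventually_rel_of_pow [Group.FG Λ] (h : IsGluing e charts R) (t : WithBot 𝒰.S) (w w' : W) :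
    ∀ᶠ n : ℕ in Filter.atTop, ∀ a : Λ, R t (a ^ n.factorial, w) (1, w') → R t (1, w) (1, w') := by
  by_cases h1 : R t (1, w) (1, w')
  · exact Filter.Eventually.of_forall fun _ _ _ => h1
  by_cases hg : ∃ g, R t (g, w) (1, w')
  · obtain ⟨g, hg⟩ := hg
    have hgM : g⁻¹ ∉ h.stab t w := fun H =>
      h1 (h.of_mul_inv_mem_stab (by rwa [mul_one]) hg)
    filter_upwards [(h.stab t w).eventually_mul_pow_factorial_notMem hgM] with n hn a ha
    exact absurd (h.mul_inv_mem_stab ha hg) (hn a)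
  · exact Filter.Eventually.of_forall fun n a ha => absurd ⟨_, ha⟩ hg

/-- The tuples in the product of the diagonal with a product of stabilisers. -/
def diagMulStab (h : IsGluing e charts R) {κ : Type*} (w : κ → W) : Subgroup (κ → Λ) where
  carrier := {b | ∃ a : Λ, ∀ k, a * b k ∈ h.stab ⊥ (w k)}
  one_mem' := ⟨1, fun k => by simp⟩
  mul_mem' := by
    rintro b c ⟨a, ha⟩ ⟨a', ha'⟩
    refine ⟨a * a', fun k => ?_⟩
    rw [Pi.mul_apply, mul_mul_mul_comm]
    exact mul_mem (ha k) (ha' k)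
  inv_mem' := by
    rintro b ⟨a, ha⟩
    refine ⟨a⁻¹, fun k => ?_⟩
    rw [Pi.inv_apply, ← mul_inv]
    exact inv_mem (ha k)

/-- If `g k` carries `w k` to `w' k` for each `k`, one common translate does so for all `k` exactly
when `g⁻¹` lies in `diagMulStab`. The claim is thus separability of that subgroup of the finitely
generated group `κ → Λ`. -/
theorem eventually_exists_rel_of_pow [Group.FG Λ] (h : IsGluing e charts R) {κ : Type*} [Finite κ]
    (w w' : κ → W) :
    ∀ᶠ n : ℕ in Filter.atTop, ∀ (a : Λ) (b : κ → Λ),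
      (∀ k, R ⊥ (b k ^ n.factorial * a, w k) (1, w' k)) → ∃ a : Λ, ∀ k, R ⊥ (a, w k) (1, w' k) := by
  by_cases h1 : ∃ a : Λ, ∀ k, R ⊥ (a, w k) (1, w' k)
  · exact Filter.Eventually.of_forall fun _ _ _ _ => h1
  by_cases hg : ∀ k, ∃ g, R ⊥ (g, w k) (1, w' k)
  · choose g hg using hg
    have hgM : g⁻¹ ∉ h.diagMulStab w := fun ⟨a, ha⟩ =>
      h1 ⟨a, fun k => h.of_mul_inv_mem_stab (by rw [mul_comm]; exact ha k) (hg k)⟩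
    filter_upwards [(h.diagMulStab w).eventually_mul_pow_factorial_notMem hgM] with n hn a b hab
    refine absurd ⟨a, fun k => ?_⟩ (hn b)
    have := h.mul_inv_mem_stab (hab k) (hg k)
    rwa [Pi.mul_apply, Pi.inv_apply, Pi.pow_apply, mul_left_comm, mul_comm a]
  · refine Filter.Eventually.of_forall fun n a b hab => absurd (fun k => ⟨_, hab k⟩) hg

/-- The relation `R t` made invariant under `m`-th powers. -/
def modPow (R : WithBot 𝒰.S → Λ × W → Λ × W → Prop) (m : ℕ) (t : WithBot 𝒰.S)
    (z z' : Λ × W) : Prop :=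
  ∃ a : Λ, R t (a ^ m * z.1, z.2) z'

theorem modPow_equivalence (h : IsGluing e charts R) (m : ℕ) (t : WithBot 𝒰.S) :
    Equivalence (modPow R m t) where
  refl z := ⟨1, by simpa using (h.equivalence t).refl z⟩
  symm := by
    rintro z z' ⟨a, ha⟩
    have := h.smul t (a⁻¹ ^ m) _ _ ha
    simp only [inv_pow, inv_mul_cancel_left] at this
    exact ⟨a⁻¹, by simpa only [inv_pow] using (h.equivalence t).symm this⟩
  trans := by
    rintro z z' z'' ⟨a, ha⟩ ⟨b, hb⟩
    refine ⟨b * a, ?_⟩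
    have := h.smul t (b ^ m) _ _ ha
    rw [mul_pow, mul_assoc]
    exact (h.equivalence t).trans this hb

theorem modPow_smul (h : IsGluing e charts R) (m : ℕ) (t : WithBot 𝒰.S) (a : Λ) {z z' : Λ × W}
    (H : modPow R m t z z') : modPow R m t (a * z.1, z.2) (a * z'.1, z'.2) := by
  obtain ⟨b, hb⟩ := H
  refine ⟨b, ?_⟩
  rw [mul_left_comm]
  exact h.smul t a _ _ hb

theorem modPow_of_rel (R : WithBot 𝒰.S → Λ × W → Λ × W → Prop) (m : ℕ) (t : WithBot 𝒰.S)
    {z z' : Λ × W} (H : R t z z') : modPow R m t z z' :=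
  ⟨1, by simpa using H⟩

theorem modPow_of_bot (h : IsGluing e charts R) (m : ℕ) (t : WithBot 𝒰.S) {z z' : Λ × W}
    (H : modPow R m ⊥ z z') : modPow R m t z z' :=
  H.imp fun _ ha => h.of_bot t _ _ ha

/-- The points of the glued structure modulo `m`-th powers. -/
def setoid (h : IsGluing e charts R) (m : ℕ) : Setoid (Λ × W) :=
  ⟨modPow R m ⊥, h.modPow_equivalence m ⊥⟩

/-- The glued structure modulo `m`-th powers. -/
def Quot (h : IsGluing e charts R) (m : ℕ) : Type _ := Quotient (h.setoid m)

/-- The `m`-th powers have finite index in a finitely generated abelian group, so coset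
representatives paired with `W` meet every class. -/
theorem finite_quot [Finite W] [Group.FG Λ] (h : IsGluing e charts R) {m : ℕ} (hm : m ≠ 0) :
    Finite (h.Quot m) := by
  have := Subgroup.finiteIndex_range_powMonoidHom_of_fg Λ hm
  let f : (Λ ⧸ (powMonoidHom (α := Λ) m).range) × W → h.Quot m :=
    fun p => Quotient.mk (h.setoid m) (p.1.out, p.2)
  refine Finite.of_surjective f fun x => ?_
  obtain ⟨⟨a, w⟩, rfl⟩ := Quotient.exists_rep x
  refine ⟨(QuotientGroup.mk a, w), Quotient.sound ?_⟩
  have : ((QuotientGroup.mk a : Λ ⧸ (powMonoidHom (α := Λ) m).range).out)⁻¹ * a ∈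
      (powMonoidHom (α := Λ) m).range := by
    rw [← QuotientGroup.eq, QuotientGroup.out_eq']
  obtain ⟨b, hb⟩ := this
  refine ⟨b, ?_⟩
  rw [powMonoidHom_apply] at hb
  simp only [hb, inv_mul_cancel_comm]
  exact (h.equivalence ⊥).refl _

instance (h : IsGluing e charts R) (m : ℕ) : MulAction Λ (h.Quot m) where
  smul a := Quotient.map (fun z => (a * z.1, z.2)) fun _ _ H => h.modPow_smul m ⊥ a H
  one_smul x := by
    induction x using Quotient.inductionOn with
    | h z => exact congrArg (Quotient.mk _) (Prod.ext (one_mul _) rfl)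
  mul_smul a b x := by
    induction x using Quotient.inductionOn with
    | h z => exact congrArg (Quotient.mk _) (Prod.ext (mul_assoc _ _ _) rfl)

/-- The class of a point of the glued structure. -/
def cls (h : IsGluing e charts R) (m : ℕ) (z : Λ × W) : h.Quot m := Quotient.mk _ z

theorem smul_cls (h : IsGluing e charts R) (m : ℕ) (a : Λ) (z : Λ × W) :
    a • h.cls m z = h.cls m (a * z.1, z.2) := rfl

theorem cls_eq_iff (h : IsGluing e charts R) (m : ℕ) (z z' : Λ × W) :
    h.cls m z = h.cls m z' ↔ modPow R m ⊥ z z' :=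
  Quotient.eq (r := h.setoid m)

theorem cls_surjective (h : IsGluing e charts R) (m : ℕ) : Function.Surjective (h.cls m) :=
  Quotient.exists_rep

/-- The relation at level `t` on the quotient. -/
def level (h : IsGluing e charts R) (m : ℕ) (t : WithBot 𝒰.S) : h.Quot m → h.Quot m → Prop :=
  Quotient.lift₂ (modPow R m t) fun _ _ _ _ H H' => propext
    ⟨fun K => (h.modPow_equivalence m t).trans
        ((h.modPow_equivalence m t).symm (h.modPow_of_bot m t H))
        ((h.modPow_equivalence m t).trans K (h.modPow_of_bot m t H')),
      fun K => (h.modPow_equivalence m t).trans (h.modPow_of_bot m t H)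
        ((h.modPow_equivalence m t).trans K
          ((h.modPow_equivalence m t).symm (h.modPow_of_bot m t H')))⟩

theorem level_equivalence (h : IsGluing e charts R) (m : ℕ) (t : WithBot 𝒰.S) :
    Equivalence (h.level m t) where
  refl x := by
    obtain ⟨z, rfl⟩ := h.cls_surjective m x
    exact (h.modPow_equivalence m t).refl z
  symm {x y} H := by
    obtain ⟨z, rfl⟩ := h.cls_surjective m x
    obtain ⟨z', rfl⟩ := h.cls_surjective m y
    exact (h.modPow_equivalence m t).symm H
  trans {x y w} H H' := by
    obtain ⟨z, rfl⟩ := h.cls_surjective m x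
    obtain ⟨z', rfl⟩ := h.cls_surjective m y
    obtain ⟨z'', rfl⟩ := h.cls_surjective m w
    exact (h.modPow_equivalence m t).trans H H'

theorem level_smul (h : IsGluing e charts R) (m : ℕ) (t : WithBot 𝒰.S) (a : Λ) {x y : h.Quot m}
    (H : h.level m t x y) : h.level m t (a • x) (a • y) := by
  obtain ⟨z, rfl⟩ := h.cls_surjective m x
  obtain ⟨z', rfl⟩ := h.cls_surjective m y
  exact h.modPow_smul m t a H

/-- The interpretation of `P_i` in the quotient. -/
def quotP (h : IsGluing e charts R) (m : ℕ) (i : Fin 𝒰.r) (x : Fin (𝒰.arity i) → h.Quot m) :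
    Prop :=
  ∃ C ∈ charts, ∃ (a : Λ) (w : Fin (𝒰.arity i) → W), (∀ k, w k ∈ C) ∧ relP i (e ∘ w) ∧
    ∀ k, x k = h.cls m (a, w k)

/-- The structure on the quotient, with distances in `T`. -/
@[reducible] def quotStructure (h : IsGluing e charts R) (m : ℕ) (T : Finset 𝒰.S) :
    𝒰.lang.Structure (h.Quot m) :=
  mkStructure (coarsening T fun t => h.level m t) (h.quotP m)

theorem quotStructure_smul_embOn (h : IsGluing e charts R) (m : ℕ) (T : Finset 𝒰.S) (a : Λ) :
    let _ := h.quotStructure m T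
    𝒰.IsEmbOn univ (a • · : h.Quot m → h.Quot m) := by
  intro _
  have hE : ∀ (a : Λ) (s : 𝒰.S) (x y : h.Quot m),
      coarsening T (fun t => h.level m t) s x y →
        coarsening T (fun t => h.level m t) s (a • x) (a • y) := by
    rintro a s x y (rfl | ⟨hs, H⟩)
    · exact Or.inl rfl
    · exact Or.inr ⟨hs, fun t ht hst => h.level_smul m t a (H t ht hst)⟩
  have hP : ∀ (a : Λ) (i : Fin 𝒰.r) (x : Fin (𝒰.arity i) → h.Quot m),
      h.quotP m i x → h.quotP m i (fun k => a • x k) := by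
    rintro a i x ⟨C, hC, b, w, hw, hp, hx⟩
    exact ⟨C, hC, a * b, w, hw, hp, fun k => congrArg (a • ·) (hx k)⟩
  refine ⟨fun x _ y _ hxy => MulAction.injective a hxy, fun s x _ y _ => ⟨fun H => ?_, hE a s x y⟩,
    fun i x _ => ⟨fun H => ?_, hP a i x⟩⟩
  · have := hE a⁻¹ s _ _ H
    rwa [show ![a • x, a • y] 0 = a • x from rfl, show ![a • x, a • y] 1 = a • y from rfl,
      inv_smul_smul, inv_smul_smul] at this
  · have := hP a⁻¹ i _ H
    simp only [Function.comp_apply, inv_smul_smul] at this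
    exact this

theorem quotStructure_isUStructure (hU : 𝒰.IsUStructure U) (h : IsGluing e charts R) (m : ℕ)
    (T : Finset 𝒰.S) (hT : 𝒰.S.Nonempty → T.Nonempty)
    (hm : ∀ w w', ∀ a : Λ, R ⊥ (a ^ m, w) (1, w') → R ⊥ (1, w) (1, w')) :
    let _ := h.quotStructure m T
    𝒰.IsUStructure (h.Quot m) := by
  intro _
  have hP : ∀ i, ∀ ϑ ∈ 𝒰.symm i, ∀ x : Fin (𝒰.arity i) → h.Quot m,
      h.quotP m i x → h.quotP m i (x ∘ ϑ) := by
    rintro i ϑ hϑ x ⟨C, hC, a, w, hw, hp, hx⟩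
    exact ⟨C, hC, a, w ∘ ϑ, fun k => hw _, (hU.symmetric i ϑ hϑ (e ∘ w)).2 hp, fun k => hx _⟩
  refine ⟨fun i ϑ hϑ x => ⟨fun H => ?_, hP i ϑ hϑ x⟩, ?_, ?_, ?_, ?_⟩
  · have := hP i ϑ⁻¹ (inv_mem hϑ) _ H
    rwa [Function.comp_assoc, ← Equiv.Perm.coe_mul, mul_inv_cancel, Equiv.Perm.coe_one,
      Function.comp_id] at this
  -- If two entries coincide modulo `m`-th powers, `hm` makes them coincide already in the chart,
  -- against distinctness in `U`.
  · rintro i x ⟨C, hC, a, w, hw, hp, hx⟩ k l hkl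
    rw [hx k, hx l, cls_eq_iff] at hkl
    obtain ⟨b, hb⟩ := hkl
    have := h.smul ⊥ a⁻¹ _ _ hb
    simp only [mul_left_comm a⁻¹, inv_mul_cancel, mul_one] at this
    exact hU.distinct i _ hp ((h.chart C hC _ (hw k) _ (hw l) ⊥).1 (hm _ _ _ this))
  · exact fun s => coarsening_equivalence (T := T) (D := fun t => h.level m t)
      (fun t => h.level_equivalence m t) s
  · exact fun s t hst x y H => coarsening_nested hst H
  · exact fun hS x y hxy => coarsening_exists_max (hT hS) hxy

/-- The distances between the points of a finite subset of a `𝒰`-structure. -/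
theorem _root_.UTuple.IsUStructure.exists_levels (hU : 𝒰.IsUStructure U) [Finite W] (e : W → U) :
    ∃ T : Finset 𝒰.S, (𝒰.S.Nonempty → T.Nonempty) ∧ ∀ w w', e w ≠ e w' →
      𝒰.S.Nonempty → ∃ t ∈ T, IsGreatest {s : 𝒰.S | ¬ relE s (e w) (e w')} t := by
  classical
  have := Fintype.ofFinite W
  by_cases hS : 𝒰.S.Nonempty
  · have hex : ∀ p : W × W, ∃ t : 𝒰.S, e p.1 ≠ e p.2 →
        IsGreatest {s : 𝒰.S | ¬ relE s (e p.1) (e p.2)} t := by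
      intro p
      by_cases hp : e p.1 = e p.2
      · exact ⟨⟨_, hS.some_mem⟩, fun h => absurd hp h⟩
      · obtain ⟨t, ht⟩ := hU.exists_max hS _ _ hp
        exact ⟨t, fun _ => ht⟩
    choose t ht using hex
    refine ⟨insert ⟨_, hS.some_mem⟩ (Finset.univ.image t), fun _ => Finset.insert_nonempty _ _,
      fun w w' hw _ => ⟨t (w, w'), ?_, ht (w, w') hw⟩⟩
    exact Finset.mem_insert_of_mem (Finset.mem_image_of_mem _ (Finset.mem_univ _))
  · exact ⟨∅, fun h => absurd h hS, fun _ _ _ h => absurd h hS⟩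

/-- A gluing of finitely many orbits is realised, as far as the charts are concerned, by an action
on a finite `𝒰`-structure. -/
theorem exists_finite_realization.{v, w} {Λ : Type v} {W : Type w} [CommGroup Λ] [Group.FG Λ]
    [Finite W] {e : W → U} {charts : Set (Set W)} {R : WithBot 𝒰.S → Λ × W → Λ × W → Prop}
    (hU : 𝒰.IsUStructure U) (h : IsGluing e charts R) :
    ∃ (D : Type (max v w)) (_ : Finite D) (_ : 𝒰.lang.Structure D) (_ : MulAction Λ D) (q : W → D),
      𝒰.IsUStructure D ∧ (∀ a : Λ, 𝒰.IsEmbOn univ (a • · : D → D)) ∧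
      (∀ (a a' : Λ) w w', R ⊥ (a, w) (a', w') → a • q w = a' • q w') ∧
      ∀ C ∈ charts, 𝒰.SameOn C q e := by
  obtain ⟨T, hT, hTmax⟩ := hU.exists_levels e
  have h1 : ∀ᶠ n : ℕ in Filter.atTop, ∀ w w', ∀ a : Λ,
      R ⊥ (a ^ n.factorial, w) (1, w') → R ⊥ (1, w) (1, w') :=
    Filter.eventually_all.2 fun w => Filter.eventually_all.2 fun w' =>
      h.eventually_rel_of_pow ⊥ w w'
  have h2 : ∀ᶠ n : ℕ in Filter.atTop, ∀ t ∈ T, ∀ w w', ∀ a : Λ,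
      R t (a ^ n.factorial, w) (1, w') → R t (1, w) (1, w') :=
    (Filter.eventually_all_finset T).2 fun t _ => Filter.eventually_all.2 fun w =>
      Filter.eventually_all.2 fun w' => h.eventually_rel_of_pow t w w'
  have h3 : ∀ᶠ n : ℕ in Filter.atTop, ∀ i, ∀ w w' : Fin (𝒰.arity i) → W,
      ∀ (a : Λ) (b : Fin (𝒰.arity i) → Λ),
      (∀ k, R ⊥ (b k ^ n.factorial * a, w k) (1, w' k)) → ∃ a : Λ, ∀ k, R ⊥ (a, w k) (1, w' k) :=
    Filter.eventually_all.2 fun i => Filter.eventually_all.2 fun w =>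
      Filter.eventually_all.2 fun w' => h.eventually_exists_rel_of_pow w w'
  -- The conditions are finite in number, because `W`, `T` and the set of symbols `P_i` are finite,
  -- so one `n` serves them all.
  obtain ⟨n, h1, h2, h3⟩ := (h1.and (h2.and h3)).exists
  let _ := h.quotStructure n.factorial T
  refine ⟨h.Quot n.factorial, h.finite_quot n.factorial_ne_zero, h.quotStructure n.factorial T,
    inferInstance, fun w => h.cls _ (1, w), h.quotStructure_isUStructure hU _ T hT h1,
    h.quotStructure_smul_embOn _ T, fun a a' w w' H => ?_, fun C hC => ?_⟩
  · rw [smul_cls, smul_cls, cls_eq_iff]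
    simpa only [mul_one] using modPow_of_rel R n.factorial ⊥ H
  have heq : ∀ w ∈ C, ∀ w' ∈ C, h.cls n.factorial (1, w) = h.cls n.factorial (1, w') ↔
      e w = e w' := by
    intro w hw w' hw'
    rw [cls_eq_iff]
    refine ⟨fun ⟨a, ha⟩ => ?_, fun H => ?_⟩
    · exact (h.chart C hC w hw w' hw' ⊥).1 (h1 w w' a (by simpa only [mul_one] using ha))
    · exact modPow_of_rel R _ ⊥ ((h.chart C hC w hw w' hw' ⊥).2 H)
  refine ⟨heq, fun s w hw w' hw' => ?_, fun i w hw => ?_⟩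
  · change coarsening T (fun t => h.level n.factorial t) s (h.cls n.factorial (1, w))
      (h.cls n.factorial (1, w')) ↔ _
    by_cases hww : e w = e w'
    · exact iff_of_true (Or.inl ((heq w hw w' hw').2 hww)) (hww ▸ (hU.equivalence s).refl _)
    -- As `t` is the greatest level separating `e w` and `e w'`, these are `E_s`-related exactly
    -- when `t < s`. In the quotient `h2` keeps them apart at `t`, and `t ∈ T` makes the coarsening
    -- see this.
    obtain ⟨t, htT, ht⟩ := hTmax w w' hww ⟨_, s.2⟩
    rw [coarsening, heq w hw w' hw', or_iff_right hww]
    refine ⟨fun ⟨_, H⟩ => ?_, fun H => ⟨⟨t, htT, ?_⟩, fun t' ht' hst' => ?_⟩⟩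
    · by_contra hs
      obtain ⟨a, ha⟩ := H t htT (ht.2 hs)
      exact ht.1 ((h.chart C hC w hw w' hw' t).1
        (h2 t htT w w' a (by simpa only [mul_one] using ha)))
    · by_contra! hst
      exact ht.1 (hU.relE_mono hst H)
    · exact modPow_of_rel R _ _ ((h.chart C hC w hw w' hw' t').2 (hU.relE_mono hst' H))
  · refine ⟨?_, fun H => ⟨C, hC, 1, w, hw, H, fun k => rfl⟩⟩
    -- The witnessing tuple matches `w` only up to a separate power in each place; `h3` replaces
    -- these by one common translate, to which `relP_of_rel` applies.
    rintro ⟨C', hC', a, w', hw', hp, hx⟩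
    have : ∀ k, ∃ b : Λ, R ⊥ (b ^ n.factorial * a, w' k) (1, w k) := fun k =>
      (h.cls_eq_iff _ _ _).1 (hx k).symm
    choose b hb using this
    obtain ⟨a', ha'⟩ := h3 i w' w a b hb
    exact h.relP_of_rel C' hC' C hC i a' w' w hw' hw ha' hp

end IsGluing

end Gluing

/-! ### Finite representations and their amalgamation -/

section FiniteRepresentations

universe u

variable {U : Type u} [𝒰.lang.Structure U]

/-- `ρ` acts by automorphisms on the finite set `D`; its values outside of `D` are irrelevant. -/
structure IsFinRep (𝒰 : UTuple) {U Λ : Type*} [𝒰.lang.Structure U] [Group Λ] (D : Finset U)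
    (ρ : Λ →* Equiv.Perm U) : Prop where
  mem : ∀ a, ∀ x ∈ D, ρ a x ∈ D
  isEmbOn : ∀ a, 𝒰.IsEmbOn (D : Set U) (ρ a)

theorem IsRandomisedUltrametricSpace.exists_embedding_of_sameOn [Countable U]
    (hU : 𝒰.IsRandomisedUltrametricSpace U) {D W : Type*} [Finite D] [𝒰.lang.Structure D]
    (hD : 𝒰.IsUStructure D) {C : Set W} (hC : C.Finite) {q : W → D} {e : W → U}
    (hq : 𝒰.SameOn C q e) : ∃ j : D ↪[𝒰.lang] U, ∀ w ∈ C, j (q w) = e w := by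
  rcases C.eq_empty_or_nonempty with rfl | ⟨w₀, hw₀⟩
  · obtain ⟨j⟩ := hU.exists_embedding hD
    exact ⟨j, fun w hw => hw.elim⟩
  have : Nonempty W := ⟨w₀⟩
  have hmem : ∀ v ∈ e '' C, Function.invFunOn e C v ∈ C := fun v hv => Function.invFunOn_mem hv
  have heq : ∀ v ∈ e '' C, e (Function.invFunOn e C v) = v := fun v hv => Function.invFunOn_eq hv
  have hemb : 𝒰.IsEmbOn (e '' C) (q ∘ Function.invFunOn e C) := by
    refine ⟨fun v hv v' hv' h => ?_, fun s v hv v' hv' => ?_, fun i x hx => ?_⟩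
    · have := (hq.eq_iff _ (hmem v hv) _ (hmem v' hv')).1 h
      rwa [heq v hv, heq v' hv'] at this
    · have := hq.relE_iff s _ (hmem v hv) _ (hmem v' hv')
      rwa [heq v hv, heq v' hv'] at this
    · have := hq.relP_iff i (Function.invFunOn e C ∘ x) fun k => hmem _ (hx k)
      rwa [show e ∘ Function.invFunOn e C ∘ x = x from funext fun k => heq _ (hx k)] at this
  obtain ⟨j, hj⟩ := hU.exists_embedding_over hD (hC.image e) hemb
  refine ⟨j, fun w hw => ?_⟩
  have hw' : e w ∈ e '' C := mem_image_of_mem e hw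
  rw [← hj (e w) hw']
  exact congrArg j ((hq.eq_iff _ hw _ (hmem _ hw')).2 (heq _ hw').symm)

theorem SameOn.comp_embedding {W X Y : Type*} [𝒰.lang.Structure X] [𝒰.lang.Structure Y]
    {C : Set W} {q : W → Y} {e : W → X} (h : 𝒰.SameOn C q e) {Z : Type*} [𝒰.lang.Structure Z]
    (j : Y ↪[𝒰.lang] Z) : 𝒰.SameOn C (j ∘ q) e where
  eq_iff w hw w' hw' := j.injective.eq_iff.trans (h.eq_iff w hw w' hw')
  relE_iff s w hw w' hw' := (relE_map_iff j s _ _).trans (h.relE_iff s w hw w' hw')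
  relP_iff i w hw := (relP_map_iff j i (q ∘ w)).trans (h.relP_iff i w hw)

/-- A gluing is realised by a finite representation inside `U`, with one of the charts fixed. -/
theorem IsGluing.exists_finRep [Countable U] (hU : 𝒰.IsRandomisedUltrametricSpace U)
    {Λ W : Type*} [CommGroup Λ] [Group.FG Λ] [Finite W] {e : W → U} {charts : Set (Set W)}
    {R : WithBot 𝒰.S → Λ × W → Λ × W → Prop} (h : IsGluing e charts R) {C₀ : Set W}
    (hC₀ : C₀ ∈ charts) :
    ∃ (D : Finset U) (ρ : Λ →* Equiv.Perm U) (q : W → U), 𝒰.IsFinRep D ρ ∧ (∀ w, q w ∈ D) ∧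
      (∀ w ∈ C₀, q w = e w) ∧ (∀ C ∈ charts, 𝒰.SameOn C q e) ∧
      ∀ (a a' : Λ) w w', R ⊥ (a, w) (a', w') → ρ a (q w) = ρ a' (q w') := by
  classical
  obtain ⟨D, _, _, _, q, hD, hsmul, hR, hq⟩ := h.exists_finite_realization hU.isUStructure
  obtain ⟨j, hj⟩ := hU.exists_embedding_of_sameOn hD (toFinite C₀) (hq C₀ hC₀)
  have := Fintype.ofFinite D
  -- The action is carried to the image of `j` and extended by the identity outside.
  let ρ : Λ →* Equiv.Perm U :=
    (Equiv.Perm.viaEmbeddingHom j.toEmbedding).comp (MulAction.toPermHom Λ D)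
  have hρ : ∀ a d, ρ a (j d) = j (a • d) := fun a d =>
    Equiv.Perm.viaEmbedding_apply (MulAction.toPerm a) j.toEmbedding d
  refine ⟨Finset.univ.image j, ρ, j ∘ q, ⟨?_, fun a => ⟨(ρ a).injective.injOn, ?_, ?_⟩⟩, ?_, hj,
    fun C hC => (hq C hC).comp_embedding j, fun a a' w w' H => ?_⟩
  · rintro a x hx
    obtain ⟨d, -, rfl⟩ := Finset.mem_image.1 hx
    rw [hρ]
    exact Finset.mem_image_of_mem _ (Finset.mem_univ _)
  · intro s x hx y hy
    obtain ⟨d, -, rfl⟩ := Finset.mem_image.1 hx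
    obtain ⟨d', -, rfl⟩ := Finset.mem_image.1 hy
    rw [hρ, hρ, relE_map_iff, relE_map_iff]
    exact (hsmul a).relE_iff s d trivial d' trivial
  · intro i x hx
    have : ∀ k, ∃ d, j d = x k := fun k => by simpa using hx k
    choose d hd using this
    obtain rfl : j ∘ d = x := funext hd
    rw [show ρ a ∘ j ∘ d = j ∘ (fun k => a • d k) from funext fun k => hρ a (d k),
      relP_map_iff j, relP_map_iff j]
    exact (hsmul a).relP_iff i d fun _ => trivial
  · exact fun w => Finset.mem_image_of_mem _ (Finset.mem_univ _)
  · rw [Function.comp_apply, Function.comp_apply, hρ, hρ, hR a a' w w' H]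

section Amalgam

variable {Δ Λ : Type*} [Group Δ] [CommGroup Λ] (φ : Δ →* Λ) (A B C : Finset U)
  (ρ : Λ →* Equiv.Perm U) (σ : Δ →* Equiv.Perm U)

/-- The point `y` of `B` is related at level `t` to the given point of the amalgam. -/
def anchor (t : WithBot 𝒰.S) : Λ × (B ⊕ C) → U → Prop
  | (a, Sum.inl b), y => relAt t (ρ a b) y
  | (a, Sum.inr c), y => ∃ x ∈ A, relAt t (c : U) x ∧ relAt t (ρ a x) y

/-- The relation at level `t` between two points of the same copy of `C`. -/
def sameCopy (t : WithBot 𝒰.S) : Λ × (B ⊕ C) → Λ × (B ⊕ C) → Prop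
  | (a, Sum.inr c), (a', Sum.inr c') => ∃ δ, a = a' * φ δ ∧ relAt t (σ δ c) (c' : U)
  | _, _ => False

/-- The relation at level `t` on the amalgam over `A` of `B` with the translates of `C`. -/
def amalgamRel (t : WithBot 𝒰.S) (z z' : Λ × (B ⊕ C)) : Prop :=
  (∃ y ∈ B, anchor A B C ρ t z y ∧ anchor A B C ρ t z' y) ∨ sameCopy φ B C σ t z z'

variable {φ A B C ρ σ}

/-- A point of a copy of `C` meets `B`, or another copy, only through points of `A`, as in the
shortest-path amalgam of ultrametric spaces. Transitivity holds because two anchors of one point at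
level `t` are `t`-related, and an anchor is inherited by `t`-related points of `B` and of the same
copy. At the bottom level an anchored point of a copy lies in `A`, where `ρ` and `σ` agree, so the
relations `P_i` transfer between charts. -/
theorem isGluing_amalgamRel (hU : 𝒰.IsUStructure U) (hφ : Function.Injective φ)
    (hρ : 𝒰.IsFinRep B ρ) (hσ : 𝒰.IsFinRep C σ) (hAB : A ⊆ B) (hAC : A ⊆ C)
    (hA : ∀ δ, ∀ x ∈ A, σ δ x = ρ (φ δ) x) (hA' : ∀ δ, ∀ x ∈ A, σ δ x ∈ A) :
    IsGluing (𝒰 := 𝒰) (Sum.elim Subtype.val Subtype.val : B ⊕ C → U)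
      {range Sum.inl, range Sum.inr} (amalgamRel φ A B C ρ σ) := by
  have hEq := hU.relAt_equivalence
  have hρt : ∀ (t : WithBot 𝒰.S) a, ∀ x ∈ B, ∀ y ∈ B,
      relAt t (ρ a x) (ρ a y) ↔ relAt t x y :=
    fun t a x hx y hy => (hρ.isEmbOn a).relAt_iff t hx hy
  have hσt : ∀ (t : WithBot 𝒰.S) δ, ∀ x ∈ C, ∀ y ∈ C,
      relAt t (σ δ x) (σ δ y) ↔ relAt t x y :=
    fun t a x hx y hy => (hσ.isEmbOn a).relAt_iff t hx hy
  have unique : ∀ (t : WithBot 𝒰.S) z y y', anchor A B C ρ t z y → anchor A B C ρ t z y' →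
      relAt t y y' := by
    rintro t ⟨a, b | c⟩ y y'
    · exact fun h h' => (hEq t).trans ((hEq t).symm h) h'
    · rintro ⟨x, hx, hcx, hxy⟩ ⟨x', hx', hcx', hxy'⟩
      have : relAt t x x' := (hEq t).trans ((hEq t).symm hcx) hcx'
      exact (hEq t).trans ((hEq t).symm hxy)
        ((hEq t).trans ((hρt t a x (hAB hx) x' (hAB hx')).2 this) hxy')
  have extend : ∀ (t : WithBot 𝒰.S) z y y', anchor A B C ρ t z y → relAt t y y' →
      anchor A B C ρ t z y' := by
    rintro t ⟨a, b | c⟩ y y'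
    · exact fun h h' => (hEq t).trans h h'
    · rintro ⟨x, hx, hcx, hxy⟩ h'
      exact ⟨x, hx, hcx, (hEq t).trans hxy h'⟩
  have copy_symm : ∀ (t : WithBot 𝒰.S) z z', sameCopy φ B C σ t z z' → sameCopy φ B C σ t z' z := by
    rintro t ⟨a, b | c⟩ ⟨a', b' | c'⟩ h
    any_goals exact h
    obtain ⟨δ, rfl, h⟩ := h
    refine ⟨δ⁻¹, by simp, ?_⟩
    rw [← hσt t δ _ (hσ.mem _ _ c'.2) _ c.2, ← Equiv.Perm.mul_apply, ← map_mul]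
    simpa using (hEq t).symm h
  have copy_trans : ∀ (t : WithBot 𝒰.S) z z' z'',
      sameCopy φ B C σ t z z' → sameCopy φ B C σ t z' z'' →
      sameCopy φ B C σ t z z'' := by
    rintro t ⟨a, b | c⟩ ⟨a', b' | c'⟩ ⟨a'', b'' | c''⟩ h h'
    any_goals first | exact h.elim | exact h'.elim
    obtain ⟨δ, rfl, h⟩ := h
    obtain ⟨δ', rfl, h'⟩ := h'
    refine ⟨δ' * δ, by rw [map_mul, mul_assoc], ?_⟩
    rw [map_mul, Equiv.Perm.mul_apply]
    exact (hEq t).trans ((hσt t δ' _ (hσ.mem _ _ c.2) _ c'.2).2 h) h'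
  have copy_anchor : ∀ (t : WithBot 𝒰.S) z z' y, sameCopy φ B C σ t z z' → anchor A B C ρ t z y →
      anchor A B C ρ t z' y := by
    rintro t ⟨a, b | c⟩ ⟨a', b' | c'⟩ y h h'
    any_goals exact h.elim
    obtain ⟨δ, rfl, h⟩ := h
    obtain ⟨x, hx, hcx, hxy⟩ := h'
    refine ⟨σ δ x, hA' δ x hx, ?_, ?_⟩
    · exact (hEq t).trans ((hEq t).symm h) ((hσt t δ _ c.2 _ (hAC hx)).2 hcx)
    · rwa [hA δ x hx, ← Equiv.Perm.mul_apply, ← map_mul]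
  refine ⟨fun t => ⟨?_, ?_, ?_⟩, ?_, ?_, ?_, ?_⟩
  · rintro ⟨a, b | c⟩
    · exact Or.inl ⟨ρ a b, hρ.mem a b b.2, (hEq t).refl _, (hEq t).refl _⟩
    · exact Or.inr ⟨1, by simp, by simpa using (hEq t).refl _⟩
  · rintro z z' (⟨y, hy, h, h'⟩ | h)
    · exact Or.inl ⟨y, hy, h', h⟩
    · exact Or.inr (copy_symm t z z' h)
  · rintro z z' z'' (⟨y, hy, h, h'⟩ | h) (⟨x, hx, k, k'⟩ | k)
    · exact Or.inl ⟨y, hy, h, extend t _ _ _ k' (unique t _ _ _ k h')⟩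
    · exact Or.inl ⟨y, hy, h, copy_anchor t _ _ _ k h'⟩
    · exact Or.inl ⟨x, hx, copy_anchor t _ _ _ (copy_symm t _ _ h) k, k'⟩
    · exact Or.inr (copy_trans t _ _ _ h k)
  · have anchor_of_bot : ∀ (t : WithBot 𝒰.S) z y,
        anchor (𝒰 := 𝒰) A B C ρ ⊥ z y → anchor A B C ρ t z y := by
      rintro t ⟨a, b | c⟩ y
      · exact fun h => hU.relAt_of_eq t h
      · rintro ⟨x, hx, hcx, hxy⟩
        exact ⟨x, hx, hU.relAt_of_eq t hcx, hU.relAt_of_eq t hxy⟩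
    rintro t z z' (⟨y, hy, h, h'⟩ | h)
    · exact Or.inl ⟨y, hy, anchor_of_bot t z y h, anchor_of_bot t z' y h'⟩
    · right
      obtain ⟨a, b | c⟩ := z <;> obtain ⟨a', b' | c'⟩ := z'
      any_goals exact h.elim
      obtain ⟨δ, h, h'⟩ := h
      exact ⟨δ, h, hU.relAt_of_eq t h'⟩
  · have anchor_smul : ∀ (t : WithBot 𝒰.S) (a : Λ) (z : Λ × (B ⊕ C)), ∀ y ∈ B,
        anchor A B C ρ t z y →
        anchor A B C ρ t (a * z.1, z.2) (ρ a y) := by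
      rintro t a ⟨a', b | c⟩ y hy
      · intro h
        change relAt t (ρ (a * a') b) (ρ a y)
        rw [map_mul, Equiv.Perm.mul_apply]
        exact (hρt t a _ (hρ.mem _ _ b.2) _ hy).2 h
      · rintro ⟨x, hx, hcx, hxy⟩
        refine ⟨x, hx, hcx, ?_⟩
        rw [map_mul, Equiv.Perm.mul_apply]
        exact (hρt t a _ (hρ.mem _ _ (hAB hx)) _ hy).2 hxy
    rintro t a z z' (⟨y, hy, h, h'⟩ | h)
    · exact Or.inl ⟨ρ a y, hρ.mem a y hy, anchor_smul t a z y hy h, anchor_smul t a z' y hy h'⟩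
    · right
      obtain ⟨a, b | c⟩ := z <;> obtain ⟨a', b' | c'⟩ := z'
      any_goals exact h.elim
      obtain ⟨δ, rfl, h'⟩ := h
      exact ⟨δ, (mul_assoc _ _ _).symm, h'⟩
  · rintro _ (rfl | rfl) _ ⟨w, rfl⟩ _ ⟨w', rfl⟩ t
    · constructor
      · rintro (⟨y, hy, h, h'⟩ | h)
        · have := (hEq t).trans h ((hEq t).symm h')
          simpa using this
        · exact h.elim
      · exact fun h => Or.inl ⟨w', w'.2, by simpa [anchor] using h,
          by simpa [anchor] using (hEq t).refl _⟩
    · constructor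
      · rintro (⟨y, hy, ⟨x, hx, hwx, hxy⟩, ⟨x', hx', hwx', hxy'⟩⟩ | ⟨δ, hδ, h⟩)
        · rw [map_one, Equiv.Perm.one_apply] at hxy hxy'
          exact (hEq t).trans ((hEq t).trans hwx hxy)
            ((hEq t).symm ((hEq t).trans hwx' hxy'))
        · rw [one_mul, ← map_one φ, hφ.eq_iff] at hδ
          subst hδ
          simpa using h
      · exact fun h => Or.inr ⟨1, by simp, by simpa using h⟩
  · have key : ∀ (a : Λ) (c : C) (y : U), anchor (𝒰 := 𝒰) A B C ρ ⊥ (a, Sum.inr c) y →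
        (c : U) ∈ A ∧ ρ a c = y := by
      rintro a c y ⟨x, hx, hcx, hxy⟩
      obtain rfl : (c : U) = x := hcx
      exact ⟨hx, hxy⟩
    have hρP : ∀ i (a : Λ) (x : Fin (𝒰.arity i) → U), (∀ k, x k ∈ B) → relP i x →
        relP i (fun k => ρ a (x k)) := fun i a x hx h => ((hρ.isEmbOn a).relP_iff i x hx).2 h
    have transfer : ∀ i (x y : Fin (𝒰.arity i) → U), relP i x → (∀ k, x k = y k) → relP i y :=
      fun i x y hx hxy => funext hxy ▸ hx
    rintro _ (rfl | rfl) _ (rfl | rfl) i a w w' hw hw' hR hP <;>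
      choose b hb using hw <;> choose b' hb' using hw' <;>
      obtain rfl := funext hb <;> obtain rfl := funext hb'
    · refine transfer i _ _ (hρP i a _ (fun k => (b k).2) hP) fun k => ?_
      rcases hR k with ⟨y, hy, h, h'⟩ | h
      · have := (show ρ a (b k : U) = y from h).trans (show ρ 1 (b' k : U) = y from h').symm
        simpa using this
      · exact h.elim
    · refine transfer i _ _ (hρP i a _ (fun k => (b k).2) hP) fun k => ?_
      rcases hR k with ⟨y, hy, h, h'⟩ | h
      · have := (show ρ a (b k : U) = y from h).trans (key _ _ _ h').2.symm
        simpa using this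
      · exact h.elim
    · have hk : ∀ k, (b k : U) ∈ A ∧ (b' k : U) = ρ a (b k) := by
        intro k
        rcases hR k with ⟨y, hy, h, h'⟩ | h
        · have := (show ρ 1 (b' k : U) = y from h').trans (key _ _ _ h).2.symm
          exact ⟨(key _ _ _ h).1, by simpa using this⟩
        · exact h.elim
      refine transfer i _ _ (hρP i a _ (fun k => hAB (hk k).1) hP) fun k => ?_
      exact (hk k).2.symm
    -- If `a = φ δ`, both tuples lie in the same copy and `σ δ` carries one to the other. Otherwise
    -- the copies differ and meet only in `B`, so all entries lie in `A` and `ρ a` does this.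
    · by_cases ha : ∃ δ, φ δ = a
      · obtain ⟨δ, rfl⟩ := ha
        refine transfer i _ _ (((hσ.isEmbOn δ).relP_iff i _ fun k => (b k).2).2 hP) fun k => ?_
        rcases hR k with ⟨y, hy, h, h'⟩ | ⟨δ', hδ, h⟩
        · have := (key _ _ _ h).2.trans (key _ _ _ h').2.symm
          rw [← hA δ _ (key _ _ _ h).1] at this
          simpa using this
        · rw [one_mul, hφ.eq_iff] at hδ
          subst hδ
          exact h
      · have hk : ∀ k, (b k : U) ∈ A ∧ (b' k : U) = ρ a (b k) := by
          intro k
          rcases hR k with ⟨y, hy, h, h'⟩ | ⟨δ, hδ, -⟩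
          · have := (key _ _ _ h').2.trans (key _ _ _ h).2.symm
            exact ⟨(key _ _ _ h).1, by simpa using this⟩
          · exact absurd ⟨δ, by rw [hδ, one_mul]⟩ ha
        refine transfer i _ _ (hρP i a _ (fun k => hAB (hk k).1) hP) fun k => ?_
        exact (hk k).2.symm

end Amalgam

/-- Amalgamation of a finite representation of `Λ` with one of a group `Δ` mapping to `Λ`. -/
theorem exists_finRep_amalgam [Countable U] (hU : 𝒰.IsRandomisedUltrametricSpace U)
    {Δ Λ : Type*} [Group Δ] [CommGroup Λ] [Group.FG Λ] {φ : Δ →* Λ} (hφ : Function.Injective φ)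
    {A B C : Finset U} {ρ : Λ →* Equiv.Perm U} {σ : Δ →* Equiv.Perm U}
    (hρ : 𝒰.IsFinRep B ρ) (hσ : 𝒰.IsFinRep C σ) (hAB : A ⊆ B) (hAC : A ⊆ C)
    (hA : ∀ δ, ∀ x ∈ A, σ δ x = ρ (φ δ) x) (hA' : ∀ δ, ∀ x ∈ A, σ δ x ∈ A) :
    ∃ (D : Finset U) (ρ' : Λ →* Equiv.Perm U) (h : U → U), 𝒰.IsFinRep D ρ' ∧ B ⊆ D ∧
      (∀ a, ∀ x ∈ B, ρ' a x = ρ a x) ∧ 𝒰.IsEmbOn (C : Set U) h ∧ (∀ x ∈ C, h x ∈ D) ∧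
      (∀ x ∈ A, h x = x) ∧ ∀ δ, ∀ x ∈ C, h (σ δ x) = ρ' (φ δ) (h x) := by
  classical
  have hglue := isGluing_amalgamRel hU.isUStructure hφ hρ hσ hAB hAC hA hA'
  obtain ⟨D, ρ', q, hD, hqD, hqe, hq, hR⟩ := hglue.exists_finRep hU (C₀ := range Sum.inl) (by simp)
  have hqB : ∀ b : B, q (Sum.inl b) = b := fun b => hqe _ (mem_range_self b)
  have hqC := hq (range Sum.inr) (by simp)
  let h : U → U := fun x => if hx : x ∈ C then q (Sum.inr ⟨x, hx⟩) else x
  have hh : ∀ x (hx : x ∈ C), h x = q (Sum.inr ⟨x, hx⟩) := fun x hx => dif_pos hx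
  refine ⟨D, ρ', h, hD, fun b hb => ?_, fun a x hx => ?_, ⟨?_, ?_, ?_⟩, fun x hx => ?_,
    fun x hx => ?_, fun δ x hx => ?_⟩
  · have := hqD (Sum.inl ⟨b, hb⟩)
    rwa [hqB] at this
  · have := hR a 1 (Sum.inl ⟨x, hx⟩) (Sum.inl ⟨ρ a x, hρ.mem a x hx⟩)
      (Or.inl ⟨ρ a x, hρ.mem a x hx, rfl, by simp [anchor]⟩)
    rwa [hqB, hqB, map_one] at this
  · intro x hx y hy hxy
    rw [hh x hx, hh y hy] at hxy
    exact (hqC.eq_iff _ (mem_range_self _) _ (mem_range_self _)).1 hxy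
  · intro s x hx y hy
    rw [hh x hx, hh y hy]
    exact hqC.relE_iff s _ (mem_range_self _) _ (mem_range_self _)
  · intro i x hx
    rw [show h ∘ x = q ∘ fun k => Sum.inr ⟨x k, hx k⟩ from funext fun k => hh _ (hx k)]
    exact hqC.relP_iff i _ fun k => mem_range_self _
  · rw [hh x hx]
    exact hqD _
  · have := hR 1 1 (Sum.inr ⟨x, hAC hx⟩) (Sum.inl ⟨x, hAB hx⟩)
      (Or.inl ⟨x, hAB hx, ⟨x, hx, rfl, by simp⟩, by simp [anchor]⟩)
    rwa [map_one, hqB, ← hh] at this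
  · have := hR (φ δ) 1 (Sum.inr ⟨x, hx⟩) (Sum.inr ⟨σ δ x, hσ.mem δ x hx⟩)
      (Or.inr ⟨δ, by simp, rfl⟩)
    rw [map_one, ← hh, ← hh] at this
    exact this.symm

end FiniteRepresentations

/-! ### Extending finite representations to the whole of the limit -/

section Representations

universe u

variable {U : Type u} [𝒰.lang.Structure U] {Λ Δ : Type*}

variable (𝒰 U) in
/-- The underlying permutations of automorphisms. -/
def permHom : (U ≃[𝒰.lang] U) →* Equiv.Perm U where
  toFun g := g.toEquiv
  map_one' := rfl
  map_mul' _ _ := rfl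

theorem aut_mul_apply (g h : U ≃[𝒰.lang] U) (x : U) : (g * h) x = g (h x) := rfl

theorem aut_one_apply (x : U) : (1 : U ≃[𝒰.lang] U) x = x := rfl

@[simp] theorem aut_inv_apply_apply (g : U ≃[𝒰.lang] U) (x : U) : g⁻¹ (g x) = x :=
  g.symm_apply_apply x

@[simp] theorem aut_apply_inv_apply (g : U ≃[𝒰.lang] U) (x : U) : g (g⁻¹ x) = x :=
  g.apply_symm_apply x

theorem rep_mul_apply [Group Λ] (π : RepSpace 𝒰.lang U Λ) (a b : Λ) (x : U) :
    π (a * b) x = π a (π b x) := by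
  rw [map_mul, aut_mul_apply]

theorem rep_one_apply [Group Λ] (π : RepSpace 𝒰.lang U Λ) (x : U) : π 1 x = x := by
  rw [map_one, aut_one_apply]

/-- The set `B` is invariant under the representation `π`. -/
def Invariant [Group Λ] (π : RepSpace 𝒰.lang U Λ) (B : Finset U) : Prop :=
  ∀ a, ∀ x ∈ B, π a x ∈ B

theorem Invariant.isFinRep [Group Λ] {π : RepSpace 𝒰.lang U Λ} {B : Finset U}
    (h : Invariant π B) : 𝒰.IsFinRep B ((permHom 𝒰 U).comp π) :=
  ⟨h, fun a => (π a).isEmbOn _⟩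

/-- The union of a chain of finite partial automorphisms. -/
theorem exists_aut_of_chain {D : ℕ → Finset U} {h : ℕ → U → U} (hD : Monotone D)
    (hh : ∀ n, 𝒰.IsEmbOn (D n : Set U) (h n)) (hcoh : ∀ m n, m ≤ n → ∀ x ∈ D m, h n x = h m x)
    (hdom : ∀ x, ∃ n, x ∈ D n) (hrange : ∀ y, ∃ n, ∃ x ∈ D n, h n x = y) :
    ∃ g : U ≃[𝒰.lang] U, ∀ n, ∀ x ∈ D n, g x = h n x := by
  choose N hN using hdom
  have key : ∀ n, ∀ x ∈ D n, h (N x) x = h n x := fun n x hx => by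
    rw [← hcoh _ _ (le_max_left (N x) n) x (hN x), ← hcoh _ _ (le_max_right (N x) n) x hx]
  have common : ∀ {k : ℕ} (x : Fin k → U), ∃ n, ∀ i, x i ∈ D n := fun {k} x =>
    ⟨Finset.univ.sup fun i => N (x i), fun i =>
      hD (Finset.le_sup (f := fun i => N (x i)) (Finset.mem_univ i)) (hN _)⟩
  let f : U → U := fun x => h (N x) x
  have hf : ∀ n, ∀ x ∈ D n, f x = h n x := key
  have hbij : Function.Bijective f := by
    refine ⟨fun x y hxy => ?_, fun y => ?_⟩
    · obtain ⟨n, hn⟩ := common ![x, y]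
      have hx : x ∈ D n := hn 0
      have hy : y ∈ D n := hn 1
      rw [hf n x hx, hf n y hy] at hxy
      exact (hh n).injOn hx hy hxy
    · obtain ⟨n, x, hx, rfl⟩ := hrange y
      exact ⟨x, hf n x hx⟩
  refine ⟨equivOfIff (Equiv.ofBijective f hbij) (fun s x y => ?_) (fun i x => ?_), hf⟩
  · obtain ⟨n, hn⟩ := common ![x, y]
    have hx : x ∈ D n := hn 0
    have hy : y ∈ D n := hn 1
    change relE s (f x) (f y) ↔ _
    rw [hf n x hx, hf n y hy]
    exact (hh n).relE_iff s x hx y hy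
  · obtain ⟨n, hn⟩ := common x
    change relP i (f ∘ x) ↔ _
    rw [show f ∘ x = h n ∘ x from funext fun k => hf n _ (hn k)]
    exact (hh n).relP_iff i x hn

variable [Countable U]

/-- Every finite representation can be extended to include a given point. -/
theorem IsFinRep.exists_extension (hU : 𝒰.IsRandomisedUltrametricSpace U) [CommGroup Λ]
    [Group.FG Λ] {B : Finset U} {ρ : Λ →* Equiv.Perm U} (hρ : 𝒰.IsFinRep B ρ) (x : U) :
    ∃ (D : Finset U) (ρ' : Λ →* Equiv.Perm U), 𝒰.IsFinRep D ρ' ∧ B ⊆ D ∧ x ∈ D ∧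
      ∀ a, ∀ y ∈ B, ρ' a y = ρ a y := by
  classical
  -- Amalgamating with `insert x B` under the trivial group adds to `B` a point `h x` of the same
  -- type as `x`. An automorphism fixing `B` then moves `h x` back to `x`.
  obtain ⟨D, ρ', h, hD, hBD, hρ', hh, hhD, hhB, -⟩ := exists_finRep_amalgam hU
    (φ := (⊥ : Subgroup Λ).subtype) (Subgroup.subtype_injective _) (A := B)
    (C := insert x B) (σ := 1) hρ
    ⟨fun _ y hy => hy, fun _ => isEmbOn_id _⟩ subset_rfl (Finset.subset_insert x B)
    (fun δ y _ => by
      obtain rfl : δ = 1 := Subsingleton.elim _ _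
      simp) (fun _ y hy => hy)
  obtain ⟨g, hg⟩ := hU.exists_aut (Finset.finite_toSet _) hh
  have hgB : ∀ y ∈ B, g⁻¹ y = y := fun y hy => by
    have : g y = y := (hg (Finset.mem_insert_of_mem hy)).trans (hhB y hy)
    conv_lhs => rw [← this]
    exact aut_inv_apply_apply g y
  have hconj : ∀ a y, (MulAut.conj (permHom 𝒰 U g⁻¹)).toMonoidHom.comp ρ' a y =
      g⁻¹ (ρ' a (g y)) := fun a y => by
    rw [MonoidHom.comp_apply, MulEquiv.coe_toMonoidHom, MulAut.conj_apply, ← map_inv, inv_inv]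
    rfl
  refine ⟨D.image (g⁻¹ : U ≃[𝒰.lang] U), (MulAut.conj (permHom 𝒰 U g⁻¹)).toMonoidHom.comp ρ',
    ⟨?_, fun a => ?_⟩, fun y hy => ?_, ?_, fun a y hy => ?_⟩
  · intro a y hy
    obtain ⟨z, hz, rfl⟩ := Finset.mem_image.1 hy
    rw [hconj, aut_apply_inv_apply]
    exact Finset.mem_image_of_mem _ (hD.mem a z hz)
  · refine IsEmbOn.congr (f := (g⁻¹ : U ≃[𝒰.lang] U) ∘ ρ' a ∘ g) ?_ fun y _ => (hconj a y).symm
    refine (Language.Equiv.isEmbOn g⁻¹ univ).comp ((hD.isEmbOn a).comp (g.isEmbOn _) ?_)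
      (mapsTo_univ _ _)
    intro y hy
    obtain ⟨z, hz, rfl⟩ := Finset.mem_image.1 (Finset.mem_coe.1 hy)
    rw [aut_apply_inv_apply]
    exact hz
  · exact Finset.mem_image.2 ⟨y, hBD hy, hgB y hy⟩
  · refine Finset.mem_image.2 ⟨h x, hhD x (Finset.mem_insert_self _ _), ?_⟩
    rw [← hg (Finset.mem_insert_self x B), aut_inv_apply_apply]
  · rw [hconj, show g y = y from (hg (Finset.mem_insert_of_mem hy)).trans (hhB y hy), hρ' a y hy,
      hgB _ (hρ.mem a y hy)]

/-- Every finite representation extends to a representation on `U`. -/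
theorem IsFinRep.exists_rep (hU : 𝒰.IsRandomisedUltrametricSpace U) [CommGroup Λ]
    [Group.FG Λ] {B : Finset U} {ρ : Λ →* Equiv.Perm U} (hρ : 𝒰.IsFinRep B ρ) :
    ∃ π : RepSpace 𝒰.lang U Λ, ∀ a, ∀ x ∈ B, π a x = ρ a x := by
  obtain ⟨f, hstart, hmono, hmeet⟩ := exists_chain_meeting
    (P := {p : Finset U × (Λ →* Equiv.Perm U) // 𝒰.IsFinRep p.1 p.2})
    (le := fun p q => p.1.1 ⊆ q.1.1 ∧ ∀ a, ∀ x ∈ p.1.1, q.1.2 a x = p.1.2 a x)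
    (fun p => ⟨subset_rfl, fun _ _ _ => rfl⟩)
    (fun p q r hpq hqr => ⟨hpq.1.trans hqr.1, fun a x hx =>
      (hqr.2 a x (hpq.1 hx)).trans (hpq.2 a x hx)⟩)
    ⟨(B, ρ), hρ⟩ (fun x : U => {p | x ∈ p.1.1}) fun x p => by
      obtain ⟨D, ρ', hD, hpD, hx, h⟩ := p.2.exists_extension hU x
      exact ⟨⟨(D, ρ'), hD⟩, hx, hpD, h⟩
  have hπ : ∀ a, ∃ g : U ≃[𝒰.lang] U, ∀ n, ∀ x ∈ (f n).1.1, g x = (f n).1.2 a x := fun a =>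
    exists_aut_of_chain (D := fun n => (f n).1.1) (h := fun n => (f n).1.2 a)
      (fun m n hmn => (hmono m n hmn).1) (fun n => (f n).2.isEmbOn a)
      (fun m n hmn => (hmono m n hmn).2 a) hmeet fun y => by
        obtain ⟨n, hn⟩ := hmeet y
        refine ⟨n, (f n).1.2 a⁻¹ y, (f n).2.mem _ _ hn, ?_⟩
        rw [← Equiv.Perm.mul_apply, ← map_mul, mul_inv_cancel, map_one, Equiv.Perm.one_apply]
  choose π hπ using hπ
  refine ⟨MonoidHom.mk' π fun a b => Language.Equiv.ext fun x => ?_, fun a x hx => ?_⟩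
  · obtain ⟨n, hn⟩ := hmeet x
    rw [aut_mul_apply, hπ _ n x hn, hπ b n x hn, hπ a n _ ((f n).2.mem b x hn), map_mul,
      Equiv.Perm.mul_apply]
  · exact (hπ a 0 x ((hstart 0).1 hx)).trans ((hstart 0).2 a x hx)

/-- A representation agrees on given finite data with one having finite orbits there. -/
theorem exists_rep_invariant (hU : 𝒰.IsRandomisedUltrametricSpace U) [CommGroup Λ]
    [Group.FG Λ] (π : RepSpace 𝒰.lang U Λ) (F : Finset Λ) (A : Finset U) :
    ∃ (π' : RepSpace 𝒰.lang U Λ) (B : Finset U), A ⊆ B ∧ Invariant π' B ∧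
      ∀ a ∈ F, ∀ x ∈ A, π' a x = π a x := by
  classical
  let B : Finset U := A ∪ Finset.image₂ (fun a x => π a x) F A
  have hAB : A ⊆ B := Finset.subset_union_left
  have hEq := hU.isUStructure.relAt_equivalence
  have hπ : ∀ a (t : WithBot 𝒰.S) x y, relAt t (π a x) (π a y) ↔ relAt t x y := fun a t x y =>
    ((π a).isEmbOn univ).relAt_iff t trivial trivial
  -- The gluing is pulled back from `π` itself, with all of `B` as its only chart. Its finite
  -- quotient retains the translates of `A` by `F`, which `B` contains.
  have hglue : IsGluing (𝒰 := 𝒰) (Subtype.val : B → U) {univ}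
      fun t (z z' : Λ × B) => relAt t (π z.1 z.2) (π z'.1 z'.2) := by
    refine ⟨fun t => ⟨fun _ => (hEq t).refl _, (hEq t).symm, (hEq t).trans⟩,
      fun t z z' h => hU.isUStructure.relAt_of_eq t h, fun t a z z' h => ?_, ?_, ?_⟩
    · rw [rep_mul_apply, rep_mul_apply, hπ]
      exact h
    · rintro _ rfl w - w' - t
      rw [rep_one_apply, rep_one_apply]
    · rintro _ rfl _ rfl i a w w' - - h hP
      have : Subtype.val ∘ w' = π a ∘ Subtype.val ∘ w := funext fun k =>
        ((h k).trans (rep_one_apply π (w' k : U))).symm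
      rwa [this, relP_map_iff]
  obtain ⟨D, ρ, q, hD, hqD, hqe, -, hR⟩ := hglue.exists_finRep hU (C₀ := univ) rfl
  obtain ⟨π', hπ'⟩ := hD.exists_rep hU
  have hBD : B ⊆ D := fun x hx => by
    have := hqD ⟨x, hx⟩
    rwa [hqe _ trivial] at this
  refine ⟨π', D, hAB.trans hBD, fun a x hx => ?_, fun a ha x hx => ?_⟩
  · rw [hπ' a x hx]
    exact hD.mem a x hx
  · have hax : π a x ∈ B :=
      Finset.mem_union_right _ (Finset.mem_image₂_of_mem ha hx)
    have := hR a 1 ⟨x, hAB hx⟩ ⟨π a x, hax⟩ (rep_one_apply π (π a x)).symm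
    rw [hqe _ trivial, hqe _ trivial, map_one, Equiv.Perm.one_apply] at this
    rw [hπ' a x (hBD (hAB hx))]
    exact this

/-- Amalgamation of invariant finite sets of representations. -/
theorem exists_rep_amalgam (hU : 𝒰.IsRandomisedUltrametricSpace U) [CommGroup Λ]
    [Group.FG Λ] [Group Δ] {φ : Δ →* Λ} (hφ : Function.Injective φ) {A B C : Finset U}
    {π : RepSpace 𝒰.lang U Λ} {σ : RepSpace 𝒰.lang U Δ} (hB : Invariant π B)
    (hC : Invariant σ C) (hA : Invariant σ A) (hAB : A ⊆ B) (hAC : A ⊆ C)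
    (h : ∀ δ, ∀ x ∈ A, σ δ x = π (φ δ) x) :
    ∃ (π' : RepSpace 𝒰.lang U Λ) (D : Finset U) (g : U ≃[𝒰.lang] U), B ⊆ D ∧ Invariant π' D ∧
      (∀ a, ∀ x ∈ B, π' a x = π a x) ∧ (∀ x ∈ C, g x ∈ D) ∧ (∀ x ∈ A, g x = x) ∧
      ∀ δ, ∀ x ∈ C, g (σ δ x) = π' (φ δ) (g x) := by
  obtain ⟨D, ρ, f, hD, hBD, hρ, hf, hfD, hfA, hfσ⟩ := exists_finRep_amalgam hU hφ
    hB.isFinRep hC.isFinRep hAB hAC h hA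
  obtain ⟨π', hπ'⟩ := hD.exists_rep hU
  obtain ⟨g, hg⟩ := hU.exists_aut (Finset.finite_toSet _) hf
  refine ⟨π', D, g, hBD, fun a x hx => ?_, fun a x hx => ?_, fun x hx => ?_, fun x hx => ?_,
    fun δ x hx => ?_⟩
  · rw [hπ' a x hx]
    exact hD.mem a x hx
  · rw [hπ' a x (hBD hx), hρ a x hx]
    rfl
  · rw [hg hx]
    exact hfD x hx
  · rw [hg (hAC hx), hfA x hx]
  · rw [hg hx, hg (hC δ x hx), hπ' _ _ (hfD x hx)]
    exact hfσ δ x hx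

end Representations

/-! ### Saturated representations and back-and-forth -/

section Saturated

universe u

variable {U : Type u} [𝒰.lang.Structure U] {Λ Δ : Type*}

/-- A representation with finite orbits which realises all extensions of its finite invariant
parts to finite invariant parts of other representations. -/
structure IsSaturated [Group Λ] (π : RepSpace 𝒰.lang U Λ) : Prop where
  exists_invariant : ∀ x, ∃ B : Finset U, x ∈ B ∧ Invariant π B
  exists_aut : ∀ (σ : RepSpace 𝒰.lang U Λ) (A C : Finset U), A ⊆ C → Invariant σ A →
    Invariant σ C → (∀ a, ∀ x ∈ A, π a x = σ a x) →
      ∃ g : U ≃[𝒰.lang] U, (∀ x ∈ A, g x = x) ∧ ∀ a, ∀ x ∈ C, g (σ a x) = π a (g x)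

theorem IsSaturated.exists_invariant_superset [Group Λ] {π : RepSpace 𝒰.lang U Λ}
    (hπ : IsSaturated π) (A : Finset U) : ∃ B : Finset U, A ⊆ B ∧ Invariant π B := by
  classical
  choose B hxB hB using hπ.exists_invariant
  refine ⟨A.biUnion B, fun x hx => Finset.mem_biUnion.2 ⟨x, hx, hxB x⟩, fun a y hy => ?_⟩
  obtain ⟨x, hx, hy⟩ := Finset.mem_biUnion.1 hy
  exact Finset.mem_biUnion.2 ⟨x, hx, hB x a y hy⟩

/-- Restrictions of saturated representations are saturated. -/
theorem IsSaturated.comp [Countable U] (hU : 𝒰.IsRandomisedUltrametricSpace U) [CommGroup Λ]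
    [Group.FG Λ] [Group Δ] {π : RepSpace 𝒰.lang U Λ} (hπ : IsSaturated π) {φ : Δ →* Λ}
    (hφ : Function.Injective φ) : IsSaturated (π.comp φ : RepSpace 𝒰.lang U Δ) where
  exists_invariant x :=
    (hπ.exists_invariant x).imp fun _ hB => ⟨hB.1, fun δ y hy => hB.2 (φ δ) y hy⟩
  exists_aut σ A C hAC hA hC h := by
    obtain ⟨B, hAB, hB⟩ := hπ.exists_invariant_superset A
    -- The set `A` is only `Δ`-invariant, so it is enlarged to the `Λ`-invariant `B`. Amalgamating
    -- `B` with `C` turns a `Δ`-extension of `A` into a `Λ`-extension of `B`, which `π` realises.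
    obtain ⟨π', D, g, hBD, hD, hπ', hgD, hgA, hgσ⟩ := exists_rep_amalgam hU hφ hB hC hA hAB hAC
      fun δ x hx => (h δ x hx).symm
    obtain ⟨k, hkB, hk⟩ := hπ.exists_aut π' B D hBD (fun a x hx => by
      rw [hπ' a x hx]
      exact hB a x hx) hD fun a x hx => (hπ' a x hx).symm
    refine ⟨k * g, fun x hx => ?_, fun δ x hx => ?_⟩
    · rw [aut_mul_apply, hgA x hx, hkB x (hAB hx)]
    · rw [aut_mul_apply, aut_mul_apply, hgσ δ x hx, hk _ _ (hgD x hx)]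
      rfl

/-- The conjugate of a representation by an automorphism. -/
def conjRep [Group Λ] (g : U ≃[𝒰.lang] U) (π : RepSpace 𝒰.lang U Λ) : RepSpace 𝒰.lang U Λ :=
  (MulAut.conj g).toMonoidHom.comp π

theorem conjRep_apply [Group Λ] (g : U ≃[𝒰.lang] U) (π : RepSpace 𝒰.lang U Λ) (a : Λ) (x : U) :
    conjRep g π a x = g (π a (g⁻¹ x)) := rfl

theorem Invariant.conjRep [Group Λ] [DecidableEq U] {π : RepSpace 𝒰.lang U Λ} {B : Finset U}
    (h : Invariant π B) (g : U ≃[𝒰.lang] U) : Invariant (conjRep g π) (B.image g) := by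
  intro a x hx
  obtain ⟨y, hy, rfl⟩ := Finset.mem_image.1 hx
  rw [conjRep_apply, aut_inv_apply_apply]
  exact Finset.mem_image_of_mem _ (h a y hy)

/-- Two saturated representations are conjugate. -/
theorem IsSaturated.exists_conj [Countable U] [Group Λ] {π π' : RepSpace 𝒰.lang U Λ}
    (hπ : IsSaturated π) (hπ' : IsSaturated π') :
    ∃ g : U ≃[𝒰.lang] U, ∀ a, π' a = g * π a * g⁻¹ := by
  classical
  -- Back-and-forth: each stage holds a whole automorphism, but only its restriction to the finite
  -- invariant set is preserved later. The two summands put each point into the domain and into the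
  -- range.
  obtain ⟨f, -, hmono, hmeet⟩ := exists_chain_meeting (ι := U ⊕ U)
    (P := {p : Finset U × (U ≃[𝒰.lang] U) //
      Invariant π p.1 ∧ ∀ a, ∀ x ∈ p.1, p.2 (π a x) = π' a (p.2 x)})
    (le := fun p q => p.1.1 ⊆ q.1.1 ∧ ∀ x ∈ p.1.1, q.1.2 x = p.1.2 x)
    (fun p => ⟨subset_rfl, fun _ _ => rfl⟩)
    (fun p q r hpq hqr => ⟨hpq.1.trans hqr.1, fun x hx =>
      (hqr.2 x (hpq.1 hx)).trans (hpq.2 x hx)⟩)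
    ⟨(∅, 1), fun _ _ h => absurd h (Finset.notMem_empty _),
      fun _ _ h => absurd h (Finset.notMem_empty _)⟩
    (Sum.elim (fun x => {p | x ∈ p.1.1}) fun y => {p | ∃ x ∈ p.1.1, p.1.2 x = y}) (by
      rintro (x | y) ⟨⟨A, g⟩, hA, hg⟩
      · obtain ⟨B, hAB, hB⟩ := hπ.exists_invariant_superset (insert x A)
        obtain ⟨k, hkA, hk⟩ := hπ'.exists_aut (conjRep g π) (A.image g) (B.image g)
          (Finset.image_subset_image ((Finset.subset_insert x A).trans hAB))
          (hA.conjRep g) (hB.conjRep g) (fun a z hz => by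
            obtain ⟨w, hw, rfl⟩ := Finset.mem_image.1 hz
            rw [conjRep_apply, aut_inv_apply_apply]
            exact (hg a w hw).symm)
        refine ⟨⟨(B, k * g), hB, fun a z hz => ?_⟩, hAB (Finset.mem_insert_self x A),
          (Finset.subset_insert x A).trans hAB, fun z hz => ?_⟩
        · have := hk a (g z) (Finset.mem_image_of_mem _ hz)
          rwa [conjRep_apply, aut_inv_apply_apply] at this
        · exact hkA _ (Finset.mem_image_of_mem _ hz)
      · obtain ⟨B, hAB, hB⟩ := hπ'.exists_invariant_superset (insert y (A.image g))
        obtain ⟨hyB, hAB⟩ := Finset.insert_subset_iff.1 hAB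
        let C := B.image (g⁻¹ : U ≃[𝒰.lang] U)
        have hAC : A ⊆ C := fun x hx => Finset.mem_image.2
          ⟨g x, hAB (Finset.mem_image_of_mem _ hx), aut_inv_apply_apply g x⟩
        have hσ : ∀ a x, conjRep g⁻¹ π' a x = g⁻¹ (π' a (g x)) := fun a x => by
          rw [conjRep_apply, inv_inv]
        have hC : Invariant (conjRep g⁻¹ π') C := hB.conjRep g⁻¹
        have hσA : ∀ a, ∀ x ∈ A, π a x = conjRep g⁻¹ π' a x := fun a x hx => by
          rw [hσ, ← hg a x hx, aut_inv_apply_apply]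
        -- For the back step, the part of `π'` around `y` is pulled back along `g` and realised in
        -- `π` by `k`; then `g * k⁻¹` has `y` in its range.
        obtain ⟨k, hkA, hk⟩ := hπ.exists_aut (conjRep g⁻¹ π') A C hAC
          (fun a x hx => by rw [← hσA a x hx]; exact hA a x hx) hC hσA
        refine ⟨⟨(C.image k, g * k⁻¹), fun a z hz => ?_, fun a z hz => ?_⟩,
          ⟨k (g⁻¹ y), Finset.mem_image_of_mem _ (Finset.mem_image_of_mem _ hyB), ?_⟩,
          fun x hx => ?_, fun x hx => ?_⟩
        · obtain ⟨x, hx, rfl⟩ := Finset.mem_image.1 hz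
          rw [← hk a x hx]
          exact Finset.mem_image_of_mem _ (hC a x hx)
        · obtain ⟨x, hx, rfl⟩ := Finset.mem_image.1 hz
          rw [← hk a x hx, aut_mul_apply, aut_mul_apply, aut_inv_apply_apply,
            aut_inv_apply_apply, hσ, aut_apply_inv_apply]
        · rw [aut_mul_apply, aut_inv_apply_apply, aut_apply_inv_apply]
        · exact Finset.mem_image.2 ⟨x, hAC hx, hkA x hx⟩
        · change g (k⁻¹ x) = g x
          conv_lhs => rw [← hkA x hx, aut_inv_apply_apply])
  obtain ⟨g, hg⟩ := exists_aut_of_chain (D := fun n => (f n).1.1) (h := fun n => (f n).1.2)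
    (fun m n hmn => (hmono m n hmn).1) (fun n => (f n).1.2.isEmbOn _)
    (fun m n hmn => (hmono m n hmn).2) (fun x => hmeet (Sum.inl x)) fun y => hmeet (Sum.inr y)
  refine ⟨g, fun a => Language.Equiv.ext fun y => ?_⟩
  rw [aut_mul_apply, aut_mul_apply]
  obtain ⟨n, hn⟩ := hmeet (Sum.inl (g⁻¹ y))
  rw [hg n _ ((f n).2.1 a _ hn), (f n).2.2 a _ hn, ← hg n _ hn, aut_apply_inv_apply]

theorem IsSaturated.conjRep [Group Λ] {π : RepSpace 𝒰.lang U Λ} (hπ : IsSaturated π)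
    (g : U ≃[𝒰.lang] U) : IsSaturated (conjRep g π) := by
  classical
  refine ⟨fun x => ?_, fun σ A C hAC hA hC h => ?_⟩
  · obtain ⟨B, hx, hB⟩ := hπ.exists_invariant (g⁻¹ x)
    exact ⟨B.image g, Finset.mem_image.2 ⟨_, hx, aut_apply_inv_apply g x⟩, hB.conjRep g⟩
  · obtain ⟨k, hkA, hk⟩ := hπ.exists_aut (UTuple.conjRep g⁻¹ σ)
      (A.image (g⁻¹ : U ≃[𝒰.lang] U)) (C.image (g⁻¹ : U ≃[𝒰.lang] U))
      (Finset.image_subset_image hAC) (hA.conjRep g⁻¹) (hC.conjRep g⁻¹) (by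
        intro a y hy
        obtain ⟨x, hx, rfl⟩ := Finset.mem_image.1 hy
        rw [conjRep_apply, inv_inv, aut_apply_inv_apply, ← h a x hx, conjRep_apply,
          aut_inv_apply_apply])
    refine ⟨g * k * g⁻¹, fun x hx => ?_, fun a x hx => ?_⟩
    · rw [aut_mul_apply, aut_mul_apply, hkA _ (Finset.mem_image_of_mem _ hx),
        aut_apply_inv_apply]
    · have := hk a _ (Finset.mem_image_of_mem _ hx)
      rw [conjRep_apply, inv_inv, aut_apply_inv_apply] at this
      rw [conjRep_apply, aut_mul_apply, aut_mul_apply, aut_mul_apply, aut_mul_apply, this,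
        aut_inv_apply_apply]

end Saturated

/-! ### The topology on the space of representations -/

section Topology

universe u

variable {U : Type u} [𝒰.lang.Structure U] {Λ : Type*} [Group Λ]

theorem isInducing_aut [TopologicalSpace U] [DiscreteTopology U] :
    Topology.IsInducing (fun (g : U ≃[𝒰.lang] U) (x : U) => g x) := by
  refine ⟨?_⟩
  have h := DiscreteTopology.eq_bot (α := U)
  subst h
  rfl

theorem isInducing_rep [TopologicalSpace U] [DiscreteTopology U] :
    Topology.IsInducing (fun (π : RepSpace 𝒰.lang U Λ) (a : Λ) (x : U) => π a x) :=
  (Topology.IsInducing.piMap (f := fun (_ : Λ) (g : U ≃[𝒰.lang] U) (x : U) => g x)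
    fun _ => isInducing_aut).comp
    (f := fun (π : RepSpace 𝒰.lang U Λ) a => π a) ⟨rfl⟩

theorem isOpen_setOf_apply_eq (a : Λ) (x y : U) :
    IsOpen {π : RepSpace 𝒰.lang U Λ | π a x = y} := by
  let _ : TopologicalSpace U := ⊥
  have : DiscreteTopology U := ⟨rfl⟩
  have h : Continuous fun π : RepSpace 𝒰.lang U Λ => π a x :=
    (continuous_apply x).comp ((continuous_apply a).comp isInducing_rep.continuous)
  exact (isOpen_discrete {y}).preimage h

theorem exists_finset_of_isOpen {O : Set (RepSpace 𝒰.lang U Λ)} (hO : IsOpen O)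
    {π : RepSpace 𝒰.lang U Λ} (hπ : π ∈ O) :
    ∃ (F : Finset Λ) (A : Finset U), ∀ π' : RepSpace 𝒰.lang U Λ,
      (∀ a ∈ F, ∀ x ∈ A, π' a x = π a x) → π' ∈ O := by
  classical
  let _ : TopologicalSpace U := ⊥
  have : DiscreteTopology U := ⟨rfl⟩
  obtain ⟨V, hV, rfl⟩ := isInducing_rep.isOpen_iff.1 hO
  obtain ⟨F, u, hu, huV⟩ := isOpen_pi_iff.1 hV _ hπ
  have : ∀ a, ∃ A : Finset U, a ∈ F → ∀ h : U → U, (∀ x ∈ A, h x = π a x) → h ∈ u a := by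
    intro a
    by_cases ha : a ∈ F
    · obtain ⟨A, v, hv, hvu⟩ := isOpen_pi_iff.1 (hu a ha).1 _ (hu a ha).2
      refine ⟨A, fun _ h hh => hvu fun x hx => ?_⟩
      rw [hh x hx]
      exact (hv x hx).2
    · exact ⟨∅, fun h => absurd h ha⟩
  choose A hA using this
  exact ⟨F, F.biUnion A, fun π' h => huV fun a ha => hA a ha _ fun x hx =>
    h a ha x (Finset.mem_biUnion.2 ⟨a, ha, hx⟩)⟩

theorem eqOn_of_generators {π σ : RepSpace 𝒰.lang U Λ} {B : Finset U} (hB : Invariant σ B)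
    {S : Set Λ} (hS : Subgroup.closure S = ⊤) (h : ∀ a ∈ S, ∀ x ∈ B, π a x = σ a x) (a : Λ) :
    ∀ x ∈ B, π a x = σ a x := by
  have ha : a ∈ Subgroup.closure S := hS ▸ Subgroup.mem_top a
  induction ha using Subgroup.closure_induction with
  | mem a ha => exact h a ha
  | one => exact fun x _ => by rw [rep_one_apply, rep_one_apply]
  | mul a b _ _ iha ihb =>
    intro x hx
    rw [rep_mul_apply, rep_mul_apply, ihb x hx, iha _ (hB b x hx)]
  | inv a _ ih =>
    intro x hx
    apply (π a).injective
    rw [ih _ (hB a⁻¹ x hx), ← rep_mul_apply, ← rep_mul_apply, mul_inv_cancel, rep_one_apply,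
      rep_one_apply]

/-- Since `B` is finite and `σ`-invariant, agreement on it need only be tested at finitely many
generators. -/
theorem isOpen_setOf_eqOn [Group.FG Λ] {σ : RepSpace 𝒰.lang U Λ} {B : Finset U}
    (hB : Invariant σ B) : IsOpen {π : RepSpace 𝒰.lang U Λ | ∀ a, ∀ x ∈ B, π a x = σ a x} := by
  obtain ⟨S, hS⟩ := Group.FG.out (G := Λ)
  have : {π : RepSpace 𝒰.lang U Λ | ∀ a, ∀ x ∈ B, π a x = σ a x} =
      ⋂ a ∈ S, ⋂ x ∈ B, {π | π a x = σ a x} := by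
    ext π
    simp only [mem_ofPred_eq, mem_iInter]
    exact ⟨fun h a _ => h a, fun h a => eqOn_of_generators hB hS h a⟩
  rw [this]
  exact isOpen_biInter_finset fun a _ => isOpen_biInter_finset fun x _ =>
    isOpen_setOf_apply_eq a x _

/-- Representations form a closed subset of the Polish space `Λ → U → U`. The action laws and
preservation of the relations are closed conditions, and bijectivity is automatic because `F a⁻¹`
inverts `F a`. -/
instance [Countable U] [Countable Λ] : BaireSpace (RepSpace 𝒰.lang U Λ) := by
  let _ : TopologicalSpace U := ⊥
  have : DiscreteTopology U := ⟨rfl⟩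
  have hcont : ∀ (a : Λ) (x : U), Continuous fun F : Λ → U → U => F a x := fun a x =>
    (continuous_apply x).comp (continuous_apply a)
  have hrange : (range fun (π : RepSpace 𝒰.lang U Λ) (a : Λ) (x : U) => π a x) =
      {F | (∀ x, F 1 x = x) ∧ (∀ a b x, F (a * b) x = F a (F b x)) ∧
        (∀ (a : Λ) (s : 𝒰.S) x y, relE s (F a x) (F a y) ↔ relE s x y) ∧
        ∀ (a : Λ) (i : Fin 𝒰.r) x, relP i (fun k => F a (x k)) ↔ relP i x} := by
    refine Subset.antisymm ?_ fun F ⟨h1, h2, h3, h4⟩ => ?_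
    · rintro _ ⟨π, rfl⟩
      exact ⟨rep_one_apply π, rep_mul_apply π, fun a s x y => relE_map_iff (π a) s x y,
        fun a i x => relP_map_iff (π a) i x⟩
    · refine ⟨MonoidHom.mk' (fun a => equivOfIff ⟨F a, F a⁻¹, fun x => ?_, fun x => ?_⟩
        (h3 a) (h4 a)) fun a b => Language.Equiv.ext fun x => h2 a b x, rfl⟩
      · rw [← h2, inv_mul_cancel, h1]
      · rw [← h2, mul_inv_cancel, h1]
  have hclosed : IsClosed (range fun (π : RepSpace 𝒰.lang U Λ) (a : Λ) (x : U) => π a x) := by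
    rw [hrange]
    have hcont₂ : ∀ a b x, Continuous fun F : Λ → U → U => F a (F b x) := fun a b x =>
      (continuous_prod_of_discrete_left.2 fun y => continuous_apply y :
        Continuous fun p : U × (U → U) => p.2 p.1).comp
          ((hcont b x).prodMk (continuous_apply a))
    simp only [ofPred_and, ofPred_forall]
    refine .inter ?_ (.inter ?_ (.inter ?_ ?_))
    · exact isClosed_iInter fun x => isClosed_eq (hcont 1 x) continuous_const
    · exact isClosed_iInter fun a => isClosed_iInter fun b => isClosed_iInter fun x =>
        isClosed_eq (hcont _ _) (hcont₂ a b x)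
    · exact isClosed_iInter fun a => isClosed_iInter fun s => isClosed_iInter fun x =>
        isClosed_iInter fun y =>
          (isClosed_discrete {p : U × U | relE s p.1 p.2 ↔ relE s x y}).preimage
          ((hcont a x).prodMk (hcont a y))
    · exact isClosed_iInter fun a => isClosed_iInter fun i => isClosed_iInter fun x =>
        (isClosed_discrete {y : Fin (𝒰.arity i) → U | relP i y ↔ relP i x}).preimage
          (continuous_pi fun k => hcont a (x k))
  have hemb : Topology.IsClosedEmbedding
      fun (π : RepSpace 𝒰.lang U Λ) (a : Λ) (x : U) => π a x :=
    ⟨⟨isInducing_rep, fun π π' h => MonoidHom.ext fun a => Language.Equiv.ext fun x =>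
      congrFun (congrFun h a) x⟩, hclosed⟩
  have := hemb.IsCompletelyMetrizableSpace
  infer_instance

end Topology

/-! ### Comeagreness of saturation -/

section Generic

universe u

variable {U : Type u} [Countable U] [𝒰.lang.Structure U] {Λ : Type*} [CommGroup Λ] [Group.FG Λ]

theorem eventually_exists_invariant (hU : 𝒰.IsRandomisedUltrametricSpace U) (x : U) :
    ∀ᶠ π in residual (RepSpace 𝒰.lang U Λ), ∃ B : Finset U, x ∈ B ∧ Invariant π B := by
  refine residual_of_dense_open ?_ ?_
  · rw [isOpen_iff_forall_mem_open]
    rintro π ⟨B, hx, hB⟩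
    refine ⟨_, fun σ hσ => ⟨B, hx, fun a y hy => ?_⟩, isOpen_setOf_eqOn hB, fun a y _ => rfl⟩
    rw [hσ a y hy]
    exact hB a y hy
  · rw [dense_iff_inter_open]
    rintro O hO ⟨π, hπ⟩
    obtain ⟨F, A, hFA⟩ := exists_finset_of_isOpen hO hπ
    classical
    obtain ⟨π', B, hAB, hB, h⟩ := exists_rep_invariant hU π F (insert x A)
    exact ⟨π', hFA π' fun a ha y hy => h a ha y (Finset.mem_insert_of_mem hy),
      B, hAB (Finset.mem_insert_self x A), hB⟩

/-- The condition is open because a realisation depends only on `π` on a finite invariant set. For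
density, `π` is first approximated by `π₁` with a finite invariant `B` containing `A`. If `π₁`
agrees with `σ` on `A`, amalgamation over `A` adjoins a copy of `C`; otherwise the condition is
vacuous. -/
theorem eventually_exists_aut (hU : 𝒰.IsRandomisedUltrametricSpace U)
    (σ : RepSpace 𝒰.lang U Λ) {A C : Finset U} (hAC : A ⊆ C) (hA : Invariant σ A)
    (hC : Invariant σ C) :
    ∀ᶠ π in residual (RepSpace 𝒰.lang U Λ), (∀ a, ∀ x ∈ A, π a x = σ a x) →
      ∃ g : U ≃[𝒰.lang] U, (∀ x ∈ A, g x = x) ∧ ∀ a, ∀ x ∈ C, g (σ a x) = π a (g x) := by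
  classical
  refine residual_of_dense_open ?_ ?_
  · rw [isOpen_iff_forall_mem_open]
    intro π hπ
    by_cases h : ∀ a, ∀ x ∈ A, π a x = σ a x
    · obtain ⟨g, hgA, hg⟩ := hπ h
      have hinv : Invariant π (C.image g) := by
        intro a y hy
        obtain ⟨x, hx, rfl⟩ := Finset.mem_image.1 hy
        rw [← hg a x hx]
        exact Finset.mem_image_of_mem _ (hC a x hx)
      refine ⟨_, fun π' hπ' _ => ⟨g, hgA, fun a x hx => ?_⟩, isOpen_setOf_eqOn hinv,
        fun a y _ => rfl⟩
      rw [hg a x hx, hπ' a _ (Finset.mem_image_of_mem _ hx)]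
    · push Not at h
      obtain ⟨a, x, hx, hax⟩ := h
      refine ⟨_, fun π' hπ' H => absurd (H a x hx) ?_, isOpen_setOf_apply_eq a x (π a x), rfl⟩
      rwa [show π' a x = π a x from hπ']
  · rw [dense_iff_inter_open]
    rintro O hO ⟨π, hπ⟩
    obtain ⟨F, A', hFA⟩ := exists_finset_of_isOpen hO hπ
    obtain ⟨π₁, B, hAB, hB, hπ₁⟩ := exists_rep_invariant hU π F (A' ∪ A)
    have hO₁ : ∀ π₂ : RepSpace 𝒰.lang U Λ, (∀ a, ∀ x ∈ B, π₂ a x = π₁ a x) → π₂ ∈ O :=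
      fun π₂ h => hFA π₂ fun a ha x hx => by
        have hx' := Finset.mem_union_left A hx
        rw [h a x (hAB hx'), hπ₁ a ha x hx']
    by_cases h : ∀ a, ∀ x ∈ A, π₁ a x = σ a x
    · obtain ⟨π₂, D, g, -, -, hπ₂, -, hgA, hg⟩ := exists_rep_amalgam hU
        (φ := MonoidHom.id Λ) Function.injective_id hB hC hA
        (Finset.subset_union_right.trans hAB) hAC fun a x hx => (h a x hx).symm
      exact ⟨π₂, hO₁ π₂ hπ₂, fun _ => ⟨g, hgA, hg⟩⟩
    · exact ⟨π₁, hO₁ π₁ fun _ _ _ => rfl, fun H => absurd H h⟩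

/-- The generic representation of a finitely generated abelian group is saturated. -/
theorem eventually_isSaturated (hU : 𝒰.IsRandomisedUltrametricSpace U) [Countable Λ] :
    ∀ᶠ π in residual (RepSpace 𝒰.lang U Λ), IsSaturated π := by
  obtain ⟨S, hS⟩ := Group.FG.out (G := Λ)
  have h1 : ∀ᶠ π in residual (RepSpace 𝒰.lang U Λ),
      ∀ x, ∃ B : Finset U, x ∈ B ∧ Invariant π B :=
    eventually_countable_forall.2 fun x => eventually_exists_invariant hU x
  -- There may be uncountably many `σ`, but only the values `τ` of the generators on `C` matter,
  -- leaving countably many conditions.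
  have h2 : ∀ᶠ π in residual (RepSpace 𝒰.lang U Λ),
      ∀ (A C : Finset U) (τ : S → C → U), ∀ σ : RepSpace 𝒰.lang U Λ, A ⊆ C → Invariant σ A →
        Invariant σ C → (∀ (a : S) (x : C), σ a x = τ a x) → (∀ a, ∀ x ∈ A, π a x = σ a x) →
          ∃ g : U ≃[𝒰.lang] U, (∀ x ∈ A, g x = x) ∧ ∀ a, ∀ x ∈ C, g (σ a x) = π a (g x) := by
    refine eventually_countable_forall.2 fun A => eventually_countable_forall.2 fun C =>
      eventually_countable_forall.2 fun τ => ?_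
    by_cases hσ : ∃ σ : RepSpace 𝒰.lang U Λ, A ⊆ C ∧ Invariant σ A ∧ Invariant σ C ∧
        ∀ (a : S) (x : C), σ a x = τ a x
    · obtain ⟨σ₀, hAC, hA, hC, hτ⟩ := hσ
      filter_upwards [eventually_exists_aut hU σ₀ hAC hA hC] with π hπ σ _ _ _ hσ h
      have heq : ∀ a, ∀ x ∈ C, σ a x = σ₀ a x := fun a => eqOn_of_generators hC hS
        (fun a ha x hx => (hσ ⟨a, ha⟩ ⟨x, hx⟩).trans (hτ ⟨a, ha⟩ ⟨x, hx⟩).symm) a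
      obtain ⟨g, hgA, hg⟩ := hπ fun a x hx => (h a x hx).trans (heq a x (hAC hx))
      exact ⟨g, hgA, fun a x hx => by rw [heq a x hx, hg a x hx]⟩
    · exact Filter.Eventually.of_forall fun π σ hAC hA hC hτ _ =>
        absurd ⟨σ, hAC, hA, hC, hτ⟩ hσ
  filter_upwards [h1, h2] with π h1 h2
  exact ⟨h1, fun σ A C hAC hA hC h =>
    h2 A C (fun a x => σ a x) σ hAC hA hC (fun _ _ => rfl) h⟩

theorem exists_isSaturated (hU : 𝒰.IsRandomisedUltrametricSpace U) [Countable Λ] :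
    ∃ π : RepSpace 𝒰.lang U Λ, IsSaturated π :=
  have : Nonempty (RepSpace 𝒰.lang U Λ) := ⟨1⟩
  (dense_of_mem_residual (eventually_isSaturated hU)).nonempty

theorem IsSaturated.isGenericRep (hU : 𝒰.IsRandomisedUltrametricSpace U) [Countable Λ]
    {π : RepSpace 𝒰.lang U Λ} (hπ : IsSaturated π) : IsGenericRep π :=
  Filter.mem_of_superset (eventually_isSaturated hU) fun _ hσ => hπ.exists_conj hσ

/-- Saturated representations extend to larger finitely generated groups. -/
theorem IsSaturated.exists_extension (hU : 𝒰.IsRandomisedUltrametricSpace U) {Δ : Type*}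
    [Group Δ] [Countable Λ] {π : RepSpace 𝒰.lang U Δ} (hπ : IsSaturated π) {φ : Δ →* Λ}
    (hφ : Function.Injective φ) :
    ∃ π' : RepSpace 𝒰.lang U Λ, IsSaturated π' ∧ ∀ δ, π' (φ δ) = π δ := by
  obtain ⟨π₁, hπ₁⟩ := exists_isSaturated (Λ := Λ) hU
  obtain ⟨g, hg⟩ := (hπ₁.comp hU hφ).exists_conj hπ
  exact ⟨UTuple.conjRep g π₁, hπ₁.conjRep g, fun δ => (hg δ).symm⟩

end Generic

end UTuple

/-! ### The union of a chain of saturated representations -/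

theorem mainTheorem2 (𝒰 : UTuple) (U : Type*) [Countable U] [𝒰.lang.Structure U]
    (hU : 𝒰.IsRandomisedUltrametricSpace U) (Γ : Type*) [CommGroup Γ] [Countable Γ] :
    ∃ π : RepSpace 𝒰.lang U Γ,
      ∀ Δ : Subgroup Γ, Δ.FG → IsGenericRep (π.restrict Δ) := by
  classical
  obtain ⟨π₀, hπ₀⟩ := UTuple.exists_isSaturated (Λ := (⊥ : Subgroup Γ)) hU
  obtain ⟨f, -, hmono, hmeet⟩ := exists_chain_meeting (ι := Γ)
    (P := {p : Σ Δ : Subgroup Γ, RepSpace 𝒰.lang U Δ // p.1.FG ∧ UTuple.IsSaturated p.2})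
    (le := fun p q => ∃ h : p.1.1 ≤ q.1.1, ∀ a, q.1.2 (Subgroup.inclusion h a) = p.1.2 a)
    (fun p => ⟨le_rfl, fun _ => rfl⟩)
    (fun p q r ⟨hpq, h⟩ ⟨hqr, h'⟩ => ⟨hpq.trans hqr, fun a => (h' _).trans (h a)⟩)
    ⟨⟨⊥, π₀⟩, Subgroup.FG.bot, hπ₀⟩ (fun γ => {p | γ ∈ p.1.1}) (by
      rintro γ ⟨⟨Δ, π⟩, hΔ, hπ⟩
      let Δ' := Δ ⊔ Subgroup.zpowers γ
      have hΔ' : Δ'.FG := hΔ.sup ⟨{γ}, by simp [Subgroup.zpowers_eq_closure]⟩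
      have : Group.FG Δ' := (Group.fg_iff_subgroup_fg _).2 hΔ'
      obtain ⟨π', hπ', h⟩ := hπ.exists_extension hU
        (Subgroup.inclusion_injective (le_sup_left : Δ ≤ Δ'))
      exact ⟨⟨⟨Δ', π'⟩, hΔ', hπ'⟩,
        (le_sup_right : _ ≤ Δ') (Subgroup.mem_zpowers γ), le_sup_left, h⟩)
  choose N hN using hmeet
  let π : Γ → U ≃[𝒰.lang] U := fun γ => (f (N γ)).1.2 ⟨γ, hN γ⟩
  have hπ : ∀ n γ (h : γ ∈ (f n).1.1), π γ = (f n).1.2 ⟨γ, h⟩ := fun n γ h => by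
    obtain ⟨_, h1⟩ := hmono _ _ (le_max_left n (N γ))
    obtain ⟨_, h2⟩ := hmono _ _ (le_max_right n (N γ))
    exact (h2 ⟨γ, hN γ⟩).symm.trans (h1 ⟨γ, h⟩)
  have hle : Monotone fun n => (f n).1.1 := fun m n hmn => (hmono m n hmn).1
  obtain ⟨θ, hθ⟩ : ∃ θ : RepSpace 𝒰.lang U Γ, ∀ γ, θ γ = π γ := by
    refine ⟨MonoidHom.mk' π fun a b => ?_, fun _ => rfl⟩
    have ha := hle (le_max_left (N a) (N b)) (hN a)
    have hb := hle (le_max_right (N a) (N b)) (hN b)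
    rw [hπ _ a ha, hπ _ b hb, hπ _ (a * b) (mul_mem ha hb), ← map_mul]
    rfl
  refine ⟨θ, fun Δ hΔ => ?_⟩
  have hΔ' : Group.FG Δ := (Group.fg_iff_subgroup_fg _).2 hΔ
  obtain ⟨S, hS⟩ := hΔ
  -- A finitely generated `Δ` lies inside one stage, so its restriction is that of a saturated
  -- representation of a finitely generated group.
  obtain ⟨n, hn⟩ : ∃ n, Δ ≤ (f n).1.1 := by
    refine ⟨S.sup N, hS ▸ (Subgroup.closure_le _).2 fun γ hγ => ?_⟩
    exact hle (Finset.le_sup hγ) (hN γ)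
  have : Group.FG (f n).1.1 := (Group.fg_iff_subgroup_fg _).2 (f n).2.1
  have hres : θ.restrict Δ = (f n).1.2.comp (Subgroup.inclusion hn) :=
    MonoidHom.ext fun δ => (hθ δ).trans (hπ n δ (hn δ.2))
  rw [hres]
  exact ((f n).2.2.comp hU (Subgroup.inclusion_injective hn)).isGenericRep hU
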